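/- **Setting.** Fix $p\ge 0$, $q\ge 1$, vectors $\alpha^*,\beta^*\in\mathbb R^p$, $\zeta_Y^*\in\mathbb R^q$, a matrix $\zeta_M^*\in\mathbb R^{q\times p}$ and $\tau^*\in\mathbb R$. For $i=1,2,\dots$ let $$M_i=\alpha^*T_i+\zeta_M^{*\top}X_i+E_i,\qquad Y_i=\tau^*T_i+\beta^{*\top}M_i+\zeta_Y^{*\top}X_i+\epsilon_i ,$$ where $T_i,Y_i,\epsilon_i$ are real random variables, $M_i,E_i$ are $\mathbb R^p$-valued, $X_i$ is $\mathbb R^q$-valued with first coordinate equal to $1$, the pairs $(E_i,\epsilon_i)$ are i.i.d. with mean zero, $E_i$ is independent of $\epsilon_i$, and the sequence $(E_i,\epsilon_i)_i$ is independent of the sequence $(T_i,X_i)_i$ (which may be random or fixed). Let $\mathbf T_n\in\mathbb R^n$, $\mathbf X_n\in\mathbb R^{n\times q}$, $\mathbf M_n\in\mathbb R^{n\times p}$, $\mathbf Y_n\in\mathbb R^n$ collect the first $n$ observations as rows, and put $\mathbf P_n^\perp=I-\mathbf X_n(\mathbf X_n^\top\mathbf X_n)^{-1}\mathbf X_n^\top$.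 **Moment condition.** $\mathrm{cov}(E_i)=\Sigma$ with $\Sigma$ positive definite and $\mathrm{var}(\epsilon_i)=\sigma^2$ with $0<\sigma^2<\infty$; moreover, as $n\to\infty$, $\mathbf X_n^\top\mathbf X_n/n\to\Sigma_X$, $\|\mathbf P_n^\perp\mathbf T_n\|_2^2/n\to\sigma_T^2$ and $\max_{i\le n}(\mathbf P_n^\perp\mathbf T_n)_i^2/n\to0$ in probability, for a positive definite $\Sigma_X$ and some $\sigma_T^2>0$. **Initial estimates.** $\hat\alpha_n^0,\hat\beta_n^0$ are random vectors in $\mathbb R^p$ such that for every $j$: $\sqrt n(\hat\alpha^0_{nj}-\alpha_j^*)=O_p(1)$, $\sqrt n(\hat\beta^0_{nj}-\beta_j^*)=O_p(1)$, $1/\hat\alpha^0_{nj}=O_p(\sqrt n)$ and $1/\hat\beta^0_{nj}=O_p(\sqrt n)$ (with $1/0=\infty$). Here $Z_n=O_p(a_n)$ means that for every $\delta>0$ there is $C>0$ with $P(|Z_n|\ge C|a_n|)<\delta$ for all sufficiently large $n$. **Penalized estimates.** Let $\gamma_\alpha>2\eta_\alpha>0$, $\gamma_\beta>2\eta_\beta>0$,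 $\lambda_{n\alpha},\lambda_{n\beta}\ge0$ and $$\hat w_{nj,\alpha}=|\hat\alpha^0_{nj}\hat\beta^0_{nj}|^{\gamma_\alpha}+|\hat\alpha^0_{nj}|^{2\eta_\alpha},\qquad \hat w_{nj,\beta}=|\hat\alpha^0_{nj}\hat\beta^0_{nj}|^{\gamma_\beta}+|\hat\beta^0_{nj}|^{2\eta_\beta}.$$ Let $\hat\alpha_n$ be the $\alpha$-component of any minimizer over $(\alpha,\zeta_M)\in\mathbb R^p\times\mathbb R^{q\times p}$ of $$\|\mathbf M_n-\mathbf T_n\alpha^\top-\mathbf X_n\zeta_M\|_F^2+\lambda_{n\alpha}\sum_{j=1}^p|\alpha_j|/\hat w_{nj,\alpha},$$ and $\hat\beta_n$ the $\beta$-component of any minimizer over $(\tau,\zeta_Y,\beta)\in\mathbb R\times\mathbb R^q\times\mathbb R^p$ of $$\|\mathbf Y_n-\mathbf T_n\tau-\mathbf X_n\zeta_Y-\mathbf M_n\beta\|_2^2+\lambda_{n\beta}\sum_{j=1}^p|\beta_j|/\hat w_{nj,\beta}$$ (each almost surely on the event that the weights involved are nonzero, and arbitrary elsewhere). **Theorem.**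 If $n^{1/2-\eta_\alpha}\ll\lambda_{n\alpha}\ll n^{1/2}$ and $n^{1/2-\eta_\beta}\ll\lambda_{n\beta}\ll n^{1/2}$, where $a_n\ll b_n$ means $a_n/b_n\to0$, then $$\|\hat\alpha_n-\alpha^*\|_F^2+\|\hat\beta_n-\beta^*\|_F^2\to0\ \text{ in probability,}$$ and $$\lim_{n\to\infty}P\big(\{j:\hat\alpha_{nj}\hat\beta_{nj}\ne0\}=\{j:\alpha_j^*\beta_j^*\ne0\}\big)=1 .$$ -/

import Mathlib

open MeasureTheory ProbabilityTheory Filter Topology Matrix Asymptotics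
open scoped ENNReal

namespace JointAdaptivePenalty

/-- `Z n = O_p(a n)`: for every `δ > 0` there is `C > 0` with `P(Z n ≥ C |a n|) < δ` for all
large `n`. The variables take values in `[0, ∞]`, so that `1 / 0 = ∞` is a genuine value. For
finite random variables and nonzero `a n`, asking this for all large `n` or uniformly in `n` is
the same. -/
def IsBigOp {Ω : Type*} [MeasurableSpace Ω] (μ : Measure Ω) (Z : ℕ → Ω → ℝ≥0∞) (a : ℕ → ℝ) :
    Prop :=
  ∀ δ : ℝ≥0∞, 0 < δ → ∃ C : ℝ, 0 < C ∧
    ∀ᶠ n in atTop, μ {ω | ENNReal.ofReal (C * |a n|) ≤ Z n ω} < δ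

/-- The vector of the first `n` terms of a sequence of real random variables. -/
def sampleVec {Ω : Type*} (U : ℕ → Ω → ℝ) (n : ℕ) (ω : Ω) : Fin n → ℝ :=
  fun i => U i ω

/-- The matrix whose rows are the first `n` terms of a sequence of random vectors. -/
def sampleMat {Ω : Type*} {r : ℕ} (U : ℕ → Ω → Fin r → ℝ) (n : ℕ) (ω : Ω) :
    Matrix (Fin n) (Fin r) ℝ :=
  Matrix.of fun i k => U i ω k

/-- The linear structural equation model
`M_i = α T_i + ζ_Mᵀ X_i + E_i`, `Y_i = τ T_i + βᵀ M_i + ζ_Yᵀ X_i + ε_i`, `i = 0, 1, 2, …`,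
where the first coordinate of `X_i` is `1`, the pairs `(E_i, ε_i)` are i.i.d. with mean zero,
`E_i` is independent of `ε_i`, and the errors are independent of the `(T_i, X_i)`. -/
structure IsLinearSEM {Ω : Type*} [MeasurableSpace Ω] (μ : Measure Ω) {p q : ℕ} [NeZero q]
    (T : ℕ → Ω → ℝ) (X : ℕ → Ω → Fin q → ℝ) (M : ℕ → Ω → Fin p → ℝ) (Y : ℕ → Ω → ℝ)
    (E : ℕ → Ω → Fin p → ℝ) (ε : ℕ → Ω → ℝ)
    (α β : Fin p → ℝ) (τ : ℝ) (ζM : Matrix (Fin q) (Fin p) ℝ) (ζY : Fin q → ℝ) : Prop where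
  measurable_T : ∀ i, Measurable (T i)
  measurable_X : ∀ i, Measurable (X i)
  measurable_E : ∀ i, Measurable (E i)
  measurable_ε : ∀ i, Measurable (ε i)
  intercept : ∀ i ω, X i ω 0 = 1
  mediator_eq : ∀ i ω, M i ω = T i ω • α + ζMᵀ *ᵥ X i ω + E i ω
  outcome_eq : ∀ i ω, Y i ω = τ * T i ω + β ⬝ᵥ M i ω + ζY ⬝ᵥ X i ω + ε i ω
  errors_iIndep : iIndepFun (fun i ω => (E i ω, ε i ω)) μ
  errors_identDistrib : ∀ i,
    IdentDistrib (fun ω => (E i ω, ε i ω)) (fun ω => (E 0 ω, ε 0 ω)) μ μ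
  indep_E_ε : ∀ i, IndepFun (E i) (ε i) μ
  indep_errors_covariates :
    IndepFun (fun ω (i : ℕ) => (E i ω, ε i ω)) (fun ω (i : ℕ) => (T i ω, X i ω)) μ
  integrable_E : ∀ i j, Integrable (fun ω => E i ω j) μ
  integrable_ε : ∀ i, Integrable (ε i) μ
  mean_E : ∀ i j, ∫ ω, E i ω j ∂μ = 0
  mean_ε : ∀ i, ∫ ω, ε i ω ∂μ = 0

/-- The matrix `I - A (AᵀA)⁻¹ Aᵀ`, the projection onto the orthogonal complement of the column
space of `A` when `A` has full column rank. -/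
noncomputable def projPerp {n q : ℕ} (A : Matrix (Fin n) (Fin q) ℝ) :
    Matrix (Fin n) (Fin n) ℝ :=
  1 - A * (Aᵀ * A)⁻¹ * Aᵀ

/-- The vector `P_X^⊥ T` computed from the first `n` observations. -/
noncomputable def residualT {Ω : Type*} {q : ℕ} (T : ℕ → Ω → ℝ) (X : ℕ → Ω → Fin q → ℝ)
    (n : ℕ) (ω : Ω) : Fin n → ℝ :=
  projPerp (sampleMat X n ω) *ᵥ sampleVec T n ω

/-- Moment condition on the errors and on the design. The design may be random, and its
convergences are convergences in probability (plain convergences for a fixed design). -/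
structure MomentCondition {Ω : Type*} [MeasurableSpace Ω] (μ : Measure Ω) {p q : ℕ}
    (T : ℕ → Ω → ℝ) (X : ℕ → Ω → Fin q → ℝ) (E : ℕ → Ω → Fin p → ℝ) (ε : ℕ → Ω → ℝ)
    (covE : Matrix (Fin p) (Fin p) ℝ) (varε : ℝ)
    (covX : Matrix (Fin q) (Fin q) ℝ) (varT : ℝ) : Prop where
  memLp_E : ∀ i j, MemLp (fun ω => E i ω j) 2 μ
  memLp_ε : ∀ i, MemLp (ε i) 2 μ
  cov_E : ∀ i j k, cov[fun ω => E i ω j, fun ω => E i ω k; μ] = covE j k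
  var_ε : ∀ i, Var[ε i; μ] = varε
  covE_posDef : covE.PosDef
  varε_pos : 0 < varε
  gram_X : ∀ k l, TendstoInMeasure μ
    (fun n ω => ((sampleMat X n ω)ᵀ * sampleMat X n ω) k l / (n : ℝ)) atTop
    (fun _ => covX k l)
  norm_residualT : TendstoInMeasure μ
    (fun n ω => (∑ i, residualT T X n ω i ^ 2) / (n : ℝ)) atTop (fun _ => varT)
  max_residualT : TendstoInMeasure μ
    (fun n ω => (⨆ i, residualT T X n ω i ^ 2) / (n : ℝ)) atTop (fun _ => (0 : ℝ))
  covX_posDef : covX.PosDef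
  varT_pos : 0 < varT

/-- Initialization condition for estimates `a0 n` of a vector `a`:
`√n (a0 n j - a j) = O_p(1)` and `1 / a0 n j = O_p(√n)` for every coordinate `j`. -/
def InitialCondition {Ω : Type*} [MeasurableSpace Ω] (μ : Measure Ω) {p : ℕ}
    (a0 : ℕ → Ω → Fin p → ℝ) (a : Fin p → ℝ) : Prop :=
  ∀ j, IsBigOp μ (fun n ω => ‖√(n : ℝ) * (a0 n ω j - a j)‖ₑ) (fun _ => 1) ∧
    IsBigOp μ (fun n ω => ‖a0 n ω j‖ₑ⁻¹) (fun n => √(n : ℝ))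

/-- The weight `|a_j b_j|^γ + |a_j|^(2η)` for the coefficient with initial estimate `a`, where
`b` is the initial estimate of the other coefficient of the pathway. -/
noncomputable def weight {p : ℕ} (γ η : ℝ) (a b : Fin p → ℝ) (j : Fin p) : ℝ :=
  |a j * b j| ^ γ + |a j| ^ (2 * η)

/-- The squared Frobenius norm. -/
def frobSq {m k : Type*} [Fintype m] [Fintype k] (A : Matrix m k ℝ) : ℝ :=
  (Aᵀ * A).trace

/-- The design matrix `(T, X)` of the mediator model. -/
def designM {n q : ℕ} (T : Fin n → ℝ) (X : Matrix (Fin n) (Fin q) ℝ) :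
    Matrix (Fin n) (Unit ⊕ Fin q) ℝ :=
  Matrix.fromCols (Matrix.replicateCol Unit T) X

/-- The design matrix `(T, X, M)` of the outcome model. -/
def designY {n p q : ℕ} (T : Fin n → ℝ) (X : Matrix (Fin n) (Fin q) ℝ)
    (M : Matrix (Fin n) (Fin p) ℝ) : Matrix (Fin n) ((Unit ⊕ Fin q) ⊕ Fin p) ℝ :=
  Matrix.fromCols (designM T X) M

/-- The `α` part (first row) of the mediator coefficients `θ_M = (α, ζ_Mᵀ)ᵀ`. -/
def alphaPart {p q : ℕ} (θ : Matrix (Unit ⊕ Fin q) (Fin p) ℝ) : Fin p → ℝ :=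
  θ (Sum.inl ())

/-- The `β` part of the outcome coefficients `θ_Y = (τ, ζ_Yᵀ, βᵀ)ᵀ`. -/
def betaPart {p q : ℕ} (θ : (Unit ⊕ Fin q) ⊕ Fin p → ℝ) : Fin p → ℝ :=
  fun j => θ (Sum.inr j)

/-- Penalized quadratic loss of the mediator model, with tuning parameter `lam` and weights `w`. -/
noncomputable def objectiveM {n p q : ℕ} (T : Fin n → ℝ) (X : Matrix (Fin n) (Fin q) ℝ)
    (M : Matrix (Fin n) (Fin p) ℝ) (lam : ℝ) (w : Fin p → ℝ)
    (θ : Matrix (Unit ⊕ Fin q) (Fin p) ℝ) : ℝ :=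
  frobSq (M - designM T X * θ) + lam * ∑ j, |alphaPart θ j| / w j

/-- Penalized quadratic loss of the outcome model, with tuning parameter `lam` and weights `w`. -/
noncomputable def objectiveY {n p q : ℕ} (T : Fin n → ℝ) (X : Matrix (Fin n) (Fin q) ℝ)
    (M : Matrix (Fin n) (Fin p) ℝ) (Y : Fin n → ℝ) (lam : ℝ) (w : Fin p → ℝ)
    (θ : (Unit ⊕ Fin q) ⊕ Fin p → ℝ) : ℝ :=
  ∑ i, (Y - designY T X M *ᵥ θ) i ^ 2 + lam * ∑ j, |betaPart θ j| / w j

/-- `θhat n` minimizes the penalized loss of the mediator model for the first `n` observations,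
almost surely on the event that no weight vanishes (otherwise the penalty is undefined, and
nothing is asked). -/
def IsMediatorFit {Ω : Type*} [MeasurableSpace Ω] (μ : Measure Ω) {p q : ℕ}
    (T : ℕ → Ω → ℝ) (X : ℕ → Ω → Fin q → ℝ) (M : ℕ → Ω → Fin p → ℝ)
    (lam : ℕ → ℝ) (w : ℕ → Ω → Fin p → ℝ)
    (θhat : ℕ → Ω → Matrix (Unit ⊕ Fin q) (Fin p) ℝ) : Prop :=
  ∀ n, ∀ᵐ ω ∂μ, (∀ j, w n ω j ≠ 0) → ∀ θ,
    objectiveM (sampleVec T n ω) (sampleMat X n ω) (sampleMat M n ω) (lam n) (w n ω) (θhat n ω) ≤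
      objectiveM (sampleVec T n ω) (sampleMat X n ω) (sampleMat M n ω) (lam n) (w n ω) θ

/-- `θhat n` minimizes the penalized loss of the outcome model for the first `n` observations,
almost surely on the event that no weight vanishes. -/
def IsOutcomeFit {Ω : Type*} [MeasurableSpace Ω] (μ : Measure Ω) {p q : ℕ}
    (T : ℕ → Ω → ℝ) (X : ℕ → Ω → Fin q → ℝ) (M : ℕ → Ω → Fin p → ℝ) (Y : ℕ → Ω → ℝ)
    (lam : ℕ → ℝ) (w : ℕ → Ω → Fin p → ℝ)
    (θhat : ℕ → Ω → (Unit ⊕ Fin q) ⊕ Fin p → ℝ) : Prop :=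
  ∀ n, ∀ᵐ ω ∂μ, (∀ j, w n ω j ≠ 0) → ∀ θ,
    objectiveY (sampleVec T n ω) (sampleMat X n ω) (sampleMat M n ω) (sampleVec Y n ω)
        (lam n) (w n ω) (θhat n ω) ≤
      objectiveY (sampleVec T n ω) (sampleMat X n ω) (sampleMat M n ω) (sampleVec Y n ω)
        (lam n) (w n ω) θ

/-- The set of indices `j` with `a j * b j ≠ 0`. -/
def activeSet {p : ℕ} (a b : Fin p → ℝ) : Set (Fin p) :=
  {j | a j * b j ≠ 0}

end JointAdaptivePenalty

/-! Both fits reduce to one deterministic problem. Eliminating the unpenalized coefficients turns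
each objective into `quadLoss`, a penalized quadratic in the deviation `d` from the true
coefficients. With `R` the part of `T` orthogonal to `X`, and `D` the part of the errors `E`
orthogonal to `T` and `X`, the mediator model has Gram matrix `(R ⬝ᵥ R) • 1` and score `Eᵀ *ᵥ R`,
the outcome model Gram matrix `Dᵀ * D` and score `Dᵀ *ᵥ ε` (`quadLoss_le_of_objectiveM_minimal`,
`quadLoss_le_of_objectiveY_minimal`).

In both cases the Gram matrix divided by `n` converges to a positive definite matrix, and the score
is `O_p(√n)` by a Chebyshev inequality that uses the independence of errors and covariates. The
weights separate the coordinates. If the true coefficient is nonzero, its weight is bounded below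
and the penalty level is `O_p(√n)`. If it is zero, the initial estimate is `O_p(n^(-1/2))`, so the
weight is `O_p(n^(-η))` because `γ > 2η`, and the penalty level exceeds every multiple of `√n`.

Coercivity then gives `d = O_p(n^(-1/2))`, and deleting a coordinate where the true coefficient is
zero lowers the loss unless that coordinate already vanishes
(`tendsto_and_eventually_eq_zero_of_quadLoss_minimal`). A product of true coefficients that is
nonzero stays nonzero by consistency; one that is zero has a factor estimated as exactly zero.

All probabilistic bookkeeping is done with `tightFilter`: `K` is chosen before `n`, bounds `O_p(1)`
are arbitrary functions of `K`, and finitely many events combine by `filter_upwards`. -/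

namespace JointAdaptivePenalty

/-! ### Convergence in probability and stochastic boundedness as filter statements. -/

section TightFilter

variable {Ω : Type*} [MeasurableSpace Ω]

/-- A set of triples `(K, n, ω)` is large if for every `δ > 0`, for all large `K`, for all
large `n`, the section at `(K, n)` has probability more than `1 - δ`. Convergence in probability
is convergence along this filter, and `K` plays the role of the constant in `O_p`. -/
def tightFilter (μ : Measure Ω) : Filter (ℝ × ℕ × Ω) where
  sets := {s | ∀ δ : ℝ≥0∞, 0 < δ → ∀ᶠ K in atTop, ∀ᶠ n in atTop, μ {ω | (K, n, ω) ∉ s} < δ}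
  univ_sets := by
    intro δ hδ
    simp [hδ]
  sets_of_superset := by
    intro s t hs hst δ hδ
    filter_upwards [hs δ hδ] with K hK
    filter_upwards [hK] with n hn
    exact lt_of_le_of_lt (measure_mono fun ω (hω : (K, n, ω) ∉ t) (h : (K, n, ω) ∈ s) => hω (hst h)) hn
  inter_sets := by
    intro s t hs ht δ hδ
    have h2 : 0 < δ / 2 := ENNReal.half_pos hδ.ne'
    filter_upwards [hs _ h2, ht _ h2] with K hK hK'
    filter_upwards [hK, hK'] with n hn hn'
    calc μ {ω | (K, n, ω) ∉ s ∩ t}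
        ≤ μ ({ω | (K, n, ω) ∉ s} ∪ {ω | (K, n, ω) ∉ t}) := by
          refine measure_mono fun ω hω => ?_
          by_contra h
          simp only [Set.mem_union, Set.mem_ofPred_eq, not_or, not_not] at h
          exact hω h
      _ ≤ μ {ω | (K, n, ω) ∉ s} + μ {ω | (K, n, ω) ∉ t} := measure_union_le _ _
      _ < δ / 2 + δ / 2 := ENNReal.add_lt_add hn hn'
      _ = δ := ENNReal.add_halves δ

variable {μ : Measure Ω}

theorem eventually_tightFilter {P : ℝ × ℕ × Ω → Prop} :
    (∀ᶠ x in tightFilter μ, P x) ↔ ∀ δ : ℝ≥0∞, 0 < δ →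
      ∀ᶠ K in atTop, ∀ᶠ n in atTop, μ {ω | ¬ P (K, n, ω)} < δ :=
  Iff.rfl

/-- Eventual properties which do not involve the constant hold with probability tending to `1`. -/
theorem tendsto_measure_not_of_eventually {P : ℕ → Ω → Prop}
    (h : ∀ᶠ x in tightFilter μ, P x.2.1 x.2.2) :
    Tendsto (fun n => μ {ω | ¬ P n ω}) atTop (𝓝 0) := by
  rw [ENNReal.tendsto_nhds_zero]
  intro δ hδ
  obtain ⟨K, hK⟩ := (h δ hδ).exists
  exact hK.mono fun n hn => hn.le

theorem eventually_of_tendsto_measure_not {P : ℕ → Ω → Prop}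
    (h : Tendsto (fun n => μ {ω | ¬ P n ω}) atTop (𝓝 0)) :
    ∀ᶠ x in tightFilter μ, P x.2.1 x.2.2 := by
  rw [eventually_tightFilter]
  intro δ hδ
  exact Eventually.of_forall fun K => h.eventually_lt_const hδ

theorem tendsto_measure_one_of_eventually [IsProbabilityMeasure μ] {P : ℕ → Ω → Prop}
    (h : ∀ᶠ x in tightFilter μ, P x.2.1 x.2.2) :
    Tendsto (fun n => μ {ω | P n ω}) atTop (𝓝 1) := by
  have h0 := tendsto_measure_not_of_eventually h
  have h1 : Tendsto (fun n => 1 - μ {ω | ¬ P n ω}) atTop (𝓝 (1 - 0)) :=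
    ENNReal.Tendsto.sub tendsto_const_nhds h0 (Or.inl ENNReal.one_ne_top)
  rw [tsub_zero] at h1
  refine tendsto_of_tendsto_of_tendsto_of_le_of_le h1 tendsto_const_nhds (fun n => ?_)
    fun n => prob_le_one
  rw [tsub_le_iff_right, ← measure_univ (μ := μ)]
  refine (measure_mono fun ω _ => ?_).trans (measure_union_le _ _)
  exact em (P n ω)

theorem eventually_of_ae {P : ℕ → Ω → Prop} (h : ∀ n, ∀ᵐ ω ∂μ, P n ω) :
    ∀ᶠ x in tightFilter μ, P x.2.1 x.2.2 := by
  apply eventually_of_tendsto_measure_not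
  simp only [fun n => show μ {ω | ¬ P n ω} = 0 from h n]
  exact tendsto_const_nhds

theorem eventually_const {P : ℝ → ℕ → Prop} (h : ∀ᶠ K in atTop, ∀ᶠ n in atTop, P K n) :
    ∀ᶠ x in tightFilter μ, P x.1 x.2.1 := by
  rw [eventually_tightFilter]
  intro δ hδ
  filter_upwards [h] with K hK
  filter_upwards [hK] with n hn
  simpa [hn] using hδ

theorem tendsto_index : Tendsto (fun x : ℝ × ℕ × Ω => x.2.1) (tightFilter μ) atTop := by
  rw [tendsto_atTop]
  exact fun b => eventually_const (P := fun _ n => b ≤ n)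
    (Eventually.of_forall fun K => eventually_ge_atTop b)

/-- For variables that do not involve `K` the quantifier over `K` is idle, so limits along the
filter inherit the usual calculus of `Tendsto`. -/
theorem tendsto_iff_tendstoInMeasure {f : ℕ → Ω → ℝ} {c : ℝ} :
    Tendsto (fun x : ℝ × ℕ × Ω => f x.2.1 x.2.2) (tightFilter μ) (𝓝 c) ↔
      TendstoInMeasure μ f atTop (fun _ => c) := by
  constructor
  · intro h ε hε
    have := tendsto_measure_not_of_eventually (P := fun n ω => edist (f n ω) c < ε)
      (h (Metric.eball_mem_nhds c hε))
    simpa using this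
  · intro h
    rw [EMetric.tendsto_nhds]
    intro ε hε
    refine eventually_of_tendsto_measure_not (P := fun n ω => edist (f n ω) c < ε) ?_
    simpa using h ε hε

/-- A family of random variables which is `O_p(1)`. -/
def IsTight (μ : Measure Ω) (Z : ℝ × ℕ × Ω → ℝ) : Prop :=
  ∃ f : ℝ → ℝ, ∀ᶠ x in tightFilter μ, |Z x| ≤ f x.1

theorem IsTight.of_abs_le {Z W : ℝ × ℕ × Ω → ℝ} (hZ : IsTight μ Z)
    (h : ∀ᶠ x in tightFilter μ, |W x| ≤ Z x) : IsTight μ W := by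
  obtain ⟨f, hf⟩ := hZ
  refine ⟨f, ?_⟩
  filter_upwards [hf, h] with x h1 h2
  exact h2.trans ((le_abs_self _).trans h1)

theorem IsTight.congr {Z W : ℝ × ℕ × Ω → ℝ} (hZ : IsTight μ Z)
    (h : ∀ᶠ x in tightFilter μ, W x = Z x) : IsTight μ W := by
  obtain ⟨f, hf⟩ := hZ
  refine ⟨f, ?_⟩
  filter_upwards [hf, h] with x h1 h2
  rwa [h2]

theorem IsTight.add {Z W : ℝ × ℕ × Ω → ℝ} (hZ : IsTight μ Z) (hW : IsTight μ W) :
    IsTight μ (fun x => Z x + W x) := by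
  obtain ⟨f, hf⟩ := hZ
  obtain ⟨g, hg⟩ := hW
  refine ⟨fun K => f K + g K, ?_⟩
  filter_upwards [hf, hg] with x h1 h2
  exact (abs_add_le _ _).trans (add_le_add h1 h2)

theorem IsTight.neg {Z : ℝ × ℕ × Ω → ℝ} (hZ : IsTight μ Z) : IsTight μ (fun x => - Z x) := by
  simpa [IsTight] using hZ

theorem IsTight.abs {Z : ℝ × ℕ × Ω → ℝ} (hZ : IsTight μ Z) : IsTight μ (fun x => |Z x|) := by
  simpa [IsTight] using hZ

theorem IsTight.sub {Z W : ℝ × ℕ × Ω → ℝ} (hZ : IsTight μ Z) (hW : IsTight μ W) :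
    IsTight μ (fun x => Z x - W x) := by
  simpa only [sub_eq_add_neg] using hZ.add hW.neg

theorem IsTight.mul {Z W : ℝ × ℕ × Ω → ℝ} (hZ : IsTight μ Z) (hW : IsTight μ W) :
    IsTight μ (fun x => Z x * W x) := by
  obtain ⟨f, hf⟩ := hZ
  obtain ⟨g, hg⟩ := hW
  refine ⟨fun K => f K * g K, ?_⟩
  filter_upwards [hf, hg] with x h1 h2
  rw [abs_mul]
  exact mul_le_mul h1 h2 (abs_nonneg _) ((abs_nonneg _).trans h1)

theorem isTight_const (c : ℝ) : IsTight μ (fun _ => c) :=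
  ⟨fun _ => |c|, Eventually.of_forall fun _ => le_rfl⟩

theorem IsTight.sum {ι : Type*} {Z : ι → ℝ × ℕ × Ω → ℝ} (s : Finset ι)
    (h : ∀ i, IsTight μ (Z i)) : IsTight μ (fun x => ∑ i ∈ s, Z i x) := by
  classical
  induction s using Finset.induction_on with
  | empty => simpa using isTight_const 0
  | insert i s hi ih => simpa [Finset.sum_insert hi] using (h i).add ih

theorem isTight_of_tendsto {Z : ℝ × ℕ × Ω → ℝ} {c : ℝ}
    (h : Tendsto Z (tightFilter μ) (𝓝 c)) : IsTight μ Z := by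
  refine ⟨fun _ => |c| + 1, ?_⟩
  have := h.abs.eventually_le_const (lt_add_one |c|)
  exact this

/-- This is `o(1) * O_p(1) = o_p(1)`: since `n` is chosen after `K`, the deterministic factor beats
the bound `f K`. -/
theorem IsTight.tendsto_zero {Z : ℝ × ℕ × Ω → ℝ} (hZ : IsTight μ Z) {a : ℕ → ℝ}
    (ha : Tendsto a atTop (𝓝 0)) :
    Tendsto (fun x => a x.2.1 * Z x) (tightFilter μ) (𝓝 0) := by
  obtain ⟨f, hf⟩ := hZ
  rw [Metric.tendsto_nhds]
  intro ε hε
  have h1 : ∀ᶠ x in tightFilter μ, |a x.2.1| * |f x.1| < ε := by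
    refine eventually_const (P := fun K n => |a n| * |f K| < ε) (Eventually.of_forall fun K => ?_)
    have : Tendsto (fun n => |a n| * |f K|) atTop (𝓝 (|0| * |f K|)) := ha.abs.mul_const _
    rw [abs_zero, zero_mul] at this
    exact this.eventually_lt_const hε
  filter_upwards [hf, h1] with x hx hx1
  rw [Real.dist_eq, sub_zero, abs_mul]
  refine lt_of_le_of_lt ?_ hx1
  exact mul_le_mul_of_nonneg_left (hx.trans (le_abs_self _)) (abs_nonneg _)

theorem IsBigOp.eventually_lt {Z : ℕ → Ω → ℝ≥0∞} {a : ℕ → ℝ} (h : IsBigOp μ Z a) :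
    ∀ᶠ x in tightFilter μ, Z x.2.1 x.2.2 < ENNReal.ofReal (x.1 * |a x.2.1|) := by
  rw [eventually_tightFilter]
  intro δ hδ
  obtain ⟨C, hC, hn⟩ := h δ hδ
  filter_upwards [eventually_ge_atTop C] with K hK
  filter_upwards [hn] with n hn
  refine lt_of_le_of_lt (measure_mono fun ω hω => ?_) hn
  simp only [not_lt, Set.mem_ofPred_eq] at hω ⊢
  exact (ENNReal.ofReal_le_ofReal (mul_le_mul_of_nonneg_right hK (abs_nonneg _))).trans hω

theorem IsBigOp.isTight {Z : ℕ → Ω → ℝ} (h : IsBigOp μ (fun n ω => ‖Z n ω‖ₑ) (fun _ => 1)) :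
    IsTight μ (fun x => Z x.2.1 x.2.2) := by
  refine ⟨fun K => |K|, ?_⟩
  filter_upwards [h.eventually_lt] with x hx
  rw [abs_one, mul_one] at hx
  have h1 := hx.trans_le (ENNReal.ofReal_le_ofReal (le_abs_self x.1))
  rw [← Real.enorm_of_nonneg (abs_nonneg x.1)] at h1
  simpa [enorm_le_iff_norm_le] using h1.le

/-- In `ℝ≥0∞` the inverse of `0` is `∞`, which no finite bound dominates. -/
theorem IsBigOp.eventually_ne_zero {Z : ℕ → Ω → ℝ} {a : ℕ → ℝ}
    (h : IsBigOp μ (fun n ω => ‖Z n ω‖ₑ⁻¹) a) :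
    ∀ᶠ x in tightFilter μ, Z x.2.1 x.2.2 ≠ 0 := by
  filter_upwards [h.eventually_lt] with x hx h0
  simp [h0] at hx

end TightFilter

/-! ### Chebyshev bounds for randomly weighted sums and the law of large numbers. -/

section Moments

variable {Ω : Type*} [MeasurableSpace Ω] {μ : Measure Ω}

/-- Conditional Chebyshev inequality: weights `V` independent of uncorrelated variables `U`,
truncated where `∑ V i ^ 2` is large. -/
theorem mul_measureReal_sum_mul_le [IsProbabilityMeasure μ] {U : ℕ → Ω → ℝ} {n : ℕ}
    {V : Ω → Fin n → ℝ} {s : ℝ}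
    (hU : ∀ i k, Integrable (fun ω => U i ω * U k ω) μ)
    (hs : ∀ i k, ∫ ω, U i ω * U k ω ∂μ = if i = k then s else 0)
    (hV : Measurable V) (hind : IndepFun (fun ω i => U i ω) V μ)
    {B : ℝ} (hB : 0 ≤ B) (t : ℝ) :
    t * μ.real {ω | ∑ i, V ω i ^ 2 ≤ B ∧ t ≤ (∑ i, V ω i * U i ω) ^ 2} ≤ s * B := by
  have hs0 : 0 ≤ s := by
    have h := hs 0 0
    rw [if_pos rfl] at h
    rw [← h]
    exact integral_nonneg fun ω => mul_self_nonneg _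
  -- The weights need not have moments. Setting them to zero when their sum of squares exceeds `B`
  -- bounds them by `√B`, so that expectations factor by independence, and changes nothing on the
  -- event to be estimated.
  set φ : (Fin n → ℝ) → Fin n → ℝ := fun v i => if ∑ k, v k ^ 2 ≤ B then v i else 0 with hφ
  have hφm : ∀ i, Measurable fun v => φ v i := by
    intro i
    refine Measurable.ite (measurableSet_le (by fun_prop) measurable_const) (by fun_prop)
      measurable_const
  have hφsum : ∀ v, ∑ i, φ v i ^ 2 ≤ B := by
    intro v
    by_cases h : ∑ k, v k ^ 2 ≤ B
    · simp [hφ, h]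
    · simpa [hφ, h] using hB
  have hφle : ∀ v i, |φ v i| ≤ √B := by
    intro v i
    refine Real.abs_le_sqrt ((Finset.single_le_sum (f := fun i => φ v i ^ 2)
      (fun _ _ => sq_nonneg _) (Finset.mem_univ i)).trans (hφsum v))
  have hWm : ∀ i, Measurable fun ω => φ (V ω) i := fun i => (hφm i).comp hV
  have hWint : ∀ i k, Integrable (fun ω => φ (V ω) i * φ (V ω) k) μ := by
    intro i k
    refine Integrable.of_bound ((hWm i).mul (hWm k)).aestronglyMeasurable (√B * √B)
      (Eventually.of_forall fun ω => ?_)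
    rw [Real.norm_eq_abs, abs_mul]
    exact mul_le_mul (hφle _ _) (hφle _ _) (abs_nonneg _) (Real.sqrt_nonneg _)
  have hindik : ∀ i k : Fin n, IndepFun (fun ω => U i ω * U k ω)
      (fun ω => φ (V ω) i * φ (V ω) k) μ := by
    intro i k
    exact hind.comp (φ := fun u : ℕ → ℝ => u i * u k) (ψ := fun v => φ v i * φ v k)
      (by fun_prop) ((hφm i).mul (hφm k))
  have hint : ∀ i k : Fin n, Integrable
      (fun ω => (U i ω * U k ω) * (φ (V ω) i * φ (V ω) k)) μ :=
    fun i k => (hindik i k).integrable_mul (hU i k) (hWint i k)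
  have hexp : ∀ ω, (∑ i, φ (V ω) i * U i ω) ^ 2 =
      ∑ i : Fin n, ∑ k : Fin n, (U i ω * U k ω) * (φ (V ω) i * φ (V ω) k) := by
    intro ω
    rw [sq, Finset.sum_mul_sum]
    refine Finset.sum_congr rfl fun i _ => Finset.sum_congr rfl fun k _ => by ring
  have hintegral : ∫ ω, (∑ i, φ (V ω) i * U i ω) ^ 2 ∂μ ≤ s * B := by
    simp_rw [hexp]
    rw [integral_finsetSum _ fun i _ => integrable_finsetSum _ fun k _ => hint i k]
    have h1 : ∀ i : Fin n, ∫ ω, ∑ k : Fin n, (U i ω * U k ω) * (φ (V ω) i * φ (V ω) k) ∂μ =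
        s * ∫ ω, φ (V ω) i ^ 2 ∂μ := by
      intro i
      rw [integral_finsetSum _ fun k _ => hint i k, Finset.sum_eq_single i]
      · have := (hindik i i).integral_mul_eq_mul_integral (hU i i).1 (hWint i i).1
        simp only [Pi.mul_apply] at this
        rw [this, hs, if_pos rfl]
        simp_rw [sq]
      · intro k _ hk
        have := (hindik i k).integral_mul_eq_mul_integral (hU i k).1 (hWint i k).1
        simp only [Pi.mul_apply] at this
        rw [this, hs, if_neg (fun h => hk (Fin.ext h.symm)), zero_mul]
      · simp
    simp_rw [h1]
    rw [← Finset.mul_sum, ← integral_finsetSum]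
    · refine mul_le_mul_of_nonneg_left ?_ hs0
      calc ∫ ω, ∑ i, φ (V ω) i ^ 2 ∂μ ≤ ∫ _, B ∂μ := by
            refine integral_mono_of_nonneg
              (Eventually.of_forall fun ω => Finset.sum_nonneg fun i _ => sq_nonneg _)
              (integrable_const _) (Eventually.of_forall fun ω => hφsum _)
        _ = B := by simp
    · intro i _
      simpa only [sq] using hWint i i
  have hintsq : Integrable (fun ω => (∑ i, φ (V ω) i * U i ω) ^ 2) μ := by
    simp_rw [hexp]
    exact integrable_finsetSum _ fun i _ => integrable_finsetSum _ fun k _ => hint i k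
  rcases le_or_gt t 0 with ht | ht
  · exact (mul_nonpos_of_nonpos_of_nonneg ht measureReal_nonneg).trans (mul_nonneg hs0 hB)
  refine le_trans (mul_le_mul_of_nonneg_left ?_ ht.le)
    ((mul_meas_ge_le_integral_of_nonneg (Eventually.of_forall fun ω => sq_nonneg _) hintsq
      t).trans hintegral)
  refine measureReal_mono ?_
  rintro ω ⟨h1, h2⟩
  simpa [hφ, h1] using h2

theorem isTight_sum_mul [IsProbabilityMeasure μ] {U : ℕ → Ω → ℝ}
    {V : ∀ n : ℕ, Ω → Fin n → ℝ} {s : ℝ}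
    (hU : ∀ i k, Integrable (fun ω => U i ω * U k ω) μ)
    (hs : ∀ i k, ∫ ω, U i ω * U k ω ∂μ = if i = k then s else 0)
    (hV : ∀ n, Measurable (V n)) (hind : ∀ n, IndepFun (fun ω i => U i ω) (V n) μ)
    (hVt : IsTight μ fun x => (∑ i, V x.2.1 x.2.2 i ^ 2) / (x.2.1 : ℝ)) :
    IsTight μ fun x => (∑ i : Fin x.2.1, V x.2.1 x.2.2 i * U i x.2.2) / √(x.2.1 : ℝ) := by
  obtain ⟨f, hf⟩ := hVt
  have hs0 : 0 ≤ s := by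
    have h := hs 0 0
    rw [if_pos rfl] at h
    rw [← h]
    exact integral_nonneg fun ω => mul_self_nonneg _
  -- For `K > 0`, `g K = K * (s * |f K| + 1)`, so the Chebyshev bound `s * |f K| / g K` is at most
  -- `1 / K`; the absolute values keep `g` nonnegative everywhere.
  set g : ℝ → ℝ := fun K => |K| * (s * |f K|) + |K| with hg
  have hg0 : ∀ K, 0 ≤ g K := fun K => by positivity
  have key : ∀ᶠ x in tightFilter μ, ¬ (∑ i, V x.2.1 x.2.2 i ^ 2 ≤ |f x.1| * (x.2.1 : ℝ) ∧
      g x.1 * (x.2.1 : ℝ) ≤ (∑ i : Fin x.2.1, V x.2.1 x.2.2 i * U i x.2.2) ^ 2) := by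
    rw [eventually_tightFilter]
    intro δ hδ
    have hKδ : ∀ᶠ K : ℝ in atTop, ENNReal.ofReal K⁻¹ < δ := by
      have h := (ENNReal.tendsto_ofReal (tendsto_inv_atTop_zero (𝕜 := ℝ)))
      rw [ENNReal.ofReal_zero] at h
      exact h.eventually_lt_const hδ
    filter_upwards [hKδ, eventually_gt_atTop 0] with K hK hK0
    filter_upwards [eventually_gt_atTop 0] with n hn
    have hn' : (0 : ℝ) < n := by exact_mod_cast hn
    simp only [not_not]
    refine lt_of_le_of_lt ?_ hK
    rw [← ofReal_measureReal]
    refine ENNReal.ofReal_le_ofReal ?_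
    have h := mul_measureReal_sum_mul_le hU hs (hV n) (hind n)
      (B := |f K| * (n : ℝ)) (by positivity) (g K * n)
    set m := μ.real {ω | ∑ i, V n ω i ^ 2 ≤ |f K| * (n : ℝ) ∧
      g K * (n : ℝ) ≤ (∑ i : Fin n, V n ω i * U i ω) ^ 2}
    have hm : 0 ≤ m := measureReal_nonneg
    have hm1 : g K * m ≤ s * |f K| := by
      have : (g K * m) * n ≤ (s * |f K|) * n := by nlinarith
      exact le_of_mul_le_mul_right this hn'
    have hsf : 0 ≤ s * |f K| := by positivity
    rw [hg] at hm1
    simp only [abs_of_pos hK0] at hm1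
    have h3 : K * m * (s * |f K| + 1) ≤ 1 * (s * |f K| + 1) := by nlinarith
    have h4 := le_of_mul_le_mul_right h3 (by positivity)
    rw [← one_div, le_div_iff₀ hK0]
    linarith
  refine ⟨fun K => √(g K), ?_⟩
  filter_upwards [hf, key, tendsto_index.eventually_gt_atTop 0] with x hx hk hn
  have hn' : (0 : ℝ) < x.2.1 := by exact_mod_cast hn
  have h1 : ∑ i, V x.2.1 x.2.2 i ^ 2 ≤ |f x.1| * (x.2.1 : ℝ) := by
    have := ((le_abs_self _).trans hx).trans (le_abs_self (f x.1))
    rwa [div_le_iff₀ hn'] at this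
  have h2 : (∑ i : Fin x.2.1, V x.2.1 x.2.2 i * U i x.2.2) ^ 2 ≤ g x.1 * (x.2.1 : ℝ) := by
    by_contra h
    exact hk ⟨h1, (not_le.mp h).le⟩
  rw [abs_div, abs_of_nonneg (Real.sqrt_nonneg _), div_le_iff₀ (Real.sqrt_pos.mpr hn'),
    ← Real.sqrt_mul (hg0 _)]
  exact Real.abs_le_sqrt h2

/-- Second moments of centered i.i.d. square integrable variables. -/
theorem integrable_mul_and_integral_mul [IsProbabilityMeasure μ] {U : ℕ → Ω → ℝ}
    (hL : MemLp (U 0) 2 μ) (hmean : ∫ ω, U 0 ω ∂μ = 0)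
    (hindep : Pairwise fun i k => IndepFun (U i) (U k) μ)
    (hident : ∀ i, IdentDistrib (U i) (U 0) μ μ) :
    (∀ i k, Integrable (fun ω => U i ω * U k ω) μ) ∧
      ∀ i k, ∫ ω, U i ω * U k ω ∂μ = if i = k then ∫ ω, U 0 ω * U 0 ω ∂μ else 0 := by
  have hLi : ∀ i, MemLp (U i) 2 μ := fun i => (hident i).symm.memLp_snd hL
  refine ⟨fun i k => (hLi i).integrable_mul (hLi k), fun i k => ?_⟩
  split_ifs with h
  · subst h
    have := ((hident i).comp (u := fun x : ℝ => x * x) (by fun_prop)).integral_eq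
    exact this
  · have := (hindep h).integral_mul_eq_mul_integral (hLi i).1 (hLi k).1
    simp only [Pi.mul_apply] at this
    rw [this, (hident i).integral_eq, hmean, zero_mul]

/-- Weak law of large numbers along `tightFilter`. -/
theorem tendsto_sum_div [IsProbabilityMeasure μ] {U : ℕ → Ω → ℝ}
    (hint : Integrable (U 0) μ) (hindep : Pairwise fun i k => IndepFun (U i) (U k) μ)
    (hident : ∀ i, IdentDistrib (U i) (U 0) μ μ) :
    Tendsto (fun x : ℝ × ℕ × Ω => (∑ i : Fin x.2.1, U i x.2.2) / (x.2.1 : ℝ)) (tightFilter μ)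
      (𝓝 (∫ ω, U 0 ω ∂μ)) := by
  refine tendsto_iff_tendstoInMeasure (f := fun n ω => (∑ i : Fin n, U i ω) / (n : ℝ)) |>.2 ?_
  have hi : ∀ i, Integrable (U i) μ := fun i => (hident i).symm.integrable_snd hint
  refine tendstoInMeasure_of_tendsto_ae (fun n => ?_) ?_
  · exact ((integrable_finsetSum _ fun (i : Fin n) _ => hi i).div_const _).1
  · filter_upwards [strong_law_ae_real U hint hindep hident] with ω hω
    simpa only [Finset.sum_range] using hω

end Moments

/-! ### Penalized quadratic losses and elimination of the unpenalized coefficients. -/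

section Deterministic

/-- Penalized quadratic loss in the deviation `d` from the coefficients `b`. -/
def quadLoss {p : ℕ} (G : Matrix (Fin p) (Fin p) ℝ) (g pen b d : Fin p → ℝ) : ℝ :=
  d ⬝ᵥ G *ᵥ d - 2 * (g ⬝ᵥ d) + ∑ j, pen j * |b j + d j|

theorem dotProduct_mulVec_comm_of_transpose_eq {p : ℕ} {G : Matrix (Fin p) (Fin p) ℝ}
    (hG : Gᵀ = G) (u v : Fin p → ℝ) : u ⬝ᵥ G *ᵥ v = v ⬝ᵥ G *ᵥ u := by
  rw [dotProduct_mulVec, ← mulVec_transpose, hG, dotProduct_comm]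

/-- Converts the change of a sum of squares along the step `u - v` into a difference of the
quadratic forms in `quadLoss`. -/
theorem quad_sub {p : ℕ} {G : Matrix (Fin p) (Fin p) ℝ} (hG : Gᵀ = G) (u v : Fin p → ℝ) :
    (u - v) ⬝ᵥ G *ᵥ (u - v) - 2 * ((u - v) ⬝ᵥ G *ᵥ u) = v ⬝ᵥ G *ᵥ v - u ⬝ᵥ G *ᵥ u := by
  simp only [mulVec_sub, sub_dotProduct, dotProduct_sub]
  rw [dotProduct_mulVec_comm_of_transpose_eq hG u v]
  ring

/-- A minimizer of the penalized quadratic loss is at distance `O(1 / √n)` from `0`. -/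
theorem mul_sum_sq_le_of_quadLoss_le_zero {p : ℕ} {G : Matrix (Fin p) (Fin p) ℝ}
    {g pen b d : Fin p → ℝ} (hmin : quadLoss G g pen b d ≤ quadLoss G g pen b 0)
    (hpen : ∀ j, 0 ≤ pen j) {c n H : ℝ} (hc : 0 < c)
    (hG : c * n * ∑ j, d j ^ 2 ≤ d ⬝ᵥ G *ᵥ d) (hn : 0 ≤ n)
    (hH : ∀ j, 2 * |g j| + (if b j = 0 then 0 else pen j) ≤ H * √n) :
    n * ∑ j, d j ^ 2 ≤ p * H ^ 2 / c ^ 2 := by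
  have h1 : c * n * ∑ j, d j ^ 2 ≤ ∑ j, (2 * (g j * d j) + pen j * (|b j| - |b j + d j|)) := by
    have h2 : ∑ j, (2 * (g j * d j) + pen j * (|b j| - |b j + d j|)) =
        2 * (g ⬝ᵥ d) + (∑ j, pen j * |b j| - ∑ j, pen j * |b j + d j|) := by
      rw [Finset.sum_add_distrib, ← Finset.mul_sum, ← Finset.sum_sub_distrib]
      simp only [mul_sub, dotProduct]
    rw [h2]
    simp only [quadLoss, zero_dotProduct, dotProduct_zero, Pi.zero_apply, add_zero, mul_zero,
      sub_zero, zero_add] at hmin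
    linarith
  -- Where `b j = 0` the penalty difference is nonpositive, which is why `H` need not control `pen
  -- j` there. Young's inequality then absorbs half of the quadratic term.
  have h3 : ∀ j, 2 * (g j * d j) + pen j * (|b j| - |b j + d j|) ≤
      c * n * d j ^ 2 / 2 + H ^ 2 / (2 * c) := by
    intro j
    have h4 : 2 * (g j * d j) + pen j * (|b j| - |b j + d j|) ≤ H * √n * |d j| := by
      refine le_trans ?_ (mul_le_mul_of_nonneg_right (hH j) (abs_nonneg _))
      rw [add_mul, mul_assoc, ← abs_mul]
      refine add_le_add (by linarith [le_abs_self (g j * d j)]) ?_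
      split_ifs with hb
      · rw [hb, abs_zero, zero_add, zero_sub, zero_mul]
        nlinarith [hpen j, abs_nonneg (d j)]
      · refine mul_le_mul_of_nonneg_left ?_ (hpen j)
        have := abs_sub_abs_le_abs_sub (b j) (b j + d j)
        rwa [sub_add_cancel_left, abs_neg] at this
    refine h4.trans ?_
    have h5 : c * n * d j ^ 2 / 2 + H ^ 2 / (2 * c) - H * √n * |d j| =
        (c * (√n * |d j|) - H) ^ 2 / (2 * c) := by
      field_simp
      rw [sub_sq, mul_pow, mul_pow, sq_abs, Real.sq_sqrt hn]
      ring
    have : 0 ≤ (c * (√n * |d j|) - H) ^ 2 / (2 * c) := by positivity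
    linarith
  have h6 := h1.trans (Finset.sum_le_sum fun j _ => h3 j)
  rw [Finset.sum_add_distrib, ← Finset.sum_div, ← Finset.mul_sum, Finset.sum_const,
    Finset.card_univ, Fintype.card_fin, nsmul_eq_mul] at h6
  rw [le_div_iff₀ (by positivity)]
  have h7 : c * n * ∑ j, d j ^ 2 ≤ p * H ^ 2 / c := by
    have : (p : ℝ) * (H ^ 2 / (2 * c)) = p * H ^ 2 / c / 2 := by field_simp
    linarith
  rw [le_div_iff₀ hc] at h7
  linarith

/-- A large penalty sets the coefficient to zero. -/
theorem eq_zero_of_quadLoss_minimal {p : ℕ} {G : Matrix (Fin p) (Fin p) ℝ} (hG : Gᵀ = G)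
    {g pen b d : Fin p → ℝ} (hmin : ∀ d', quadLoss G g pen b d ≤ quadLoss G g pen b d')
    {j : Fin p} (hb : b j = 0)
    (hlarge : 2 * ∑ k, |G j k| * |d k| + |d j| * |G j j| + 2 * |g j| < pen j) : d j = 0 := by
  by_contra hd
  -- The competitor deletes coordinate `j`. As `b j = 0`, this saves the whole `pen j * |d j|`,
  -- while the quadratic and linear terms grow by at most `|d j|` times the left side of `hlarge`.
  have h1 := hmin (d - Pi.single j (d j))
  have h2 : ∑ k, pen k * |b k + (d - Pi.single j (d j) : Fin p → ℝ) k| =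
      ∑ k, pen k * |b k + d k| - pen j * |d j| := by
    rw [eq_sub_iff_add_eq, ← Finset.sum_erase_add _ _ (Finset.mem_univ j),
      ← Finset.sum_erase_add _ _ (Finset.mem_univ j), hb]
    simp only [Pi.sub_apply, Pi.single_eq_same, sub_self, add_zero, abs_zero, mul_zero, zero_add]
    congr 1
    refine Finset.sum_congr rfl fun k hk => ?_
    rw [Pi.single_eq_of_ne (Finset.ne_of_mem_erase hk), sub_zero]
  have h3 : (d - Pi.single j (d j)) ⬝ᵥ G *ᵥ (d - Pi.single j (d j)) =
      d ⬝ᵥ G *ᵥ d - 2 * (d j * (G *ᵥ d) j) + d j * (d j * G j j) := by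
    have h := dotProduct_mulVec_comm_of_transpose_eq hG d (Pi.single j (d j))
    simp only [mulVec_sub, sub_dotProduct, dotProduct_sub, h]
    rw [single_dotProduct, single_dotProduct, mulVec_single]
    simp only [Pi.smul_apply, col_apply, MulOpposite.smul_eq_mul_unop, MulOpposite.unop_op]
    ring
  unfold quadLoss at h1
  rw [h2, h3, dotProduct_sub, dotProduct_single] at h1
  have h4 : |(G *ᵥ d) j| ≤ ∑ k, |G j k| * |d k| := by
    have := Finset.abs_sum_le_sum_abs (fun k => G j k * d k) Finset.univ
    simp only [abs_mul] at this
    exact this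
  have h5 : pen j * |d j| ≤ |d j| * (2 * |(G *ᵥ d) j| + |d j| * |G j j| + 2 * |g j|) := by
    have a1 := neg_abs_le (d j * (G *ᵥ d) j)
    have a2 := le_abs_self (d j * (d j * G j j))
    have a3 := le_abs_self (g j * d j)
    simp only [abs_mul] at a1 a2 a3
    linarith
  have hpos := abs_pos.mpr hd
  have h6 : |d j| * (2 * |(G *ᵥ d) j| + |d j| * |G j j| + 2 * |g j|) < |d j| * pen j := by
    refine mul_lt_mul_of_pos_left ?_ hpos
    linarith
  linarith

theorem sum_sq_eq_dotProduct {m : Type*} [Fintype m] (v : m → ℝ) : ∑ i, v i ^ 2 = v ⬝ᵥ v := by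
  simp only [dotProduct, sq]

/-- Profiling out the unpenalized coefficients of the outcome model. -/
theorem quadLoss_le_of_objectiveY_minimal {n p q : ℕ} {T Y ε : Fin n → ℝ}
    {X : Matrix (Fin n) (Fin q) ℝ} {M E D : Matrix (Fin n) (Fin p) ℝ} {α β : Fin p → ℝ} {τ : ℝ}
    {ζM : Matrix (Fin q) (Fin p) ℝ} {ζY : Fin q → ℝ}
    (hM : M = vecMulVec T α + X * ζM + E) (hY : Y = τ • T + M *ᵥ β + X *ᵥ ζY + ε)
    {c : Fin p → ℝ} {B : Matrix (Fin q) (Fin p) ℝ} (hD : D = E - vecMulVec T c - X * B)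
    (hDT : Dᵀ *ᵥ T = 0) (hDX : Dᵀ * X = 0) {lam : ℝ} {w : Fin p → ℝ}
    {θ : (Unit ⊕ Fin q) ⊕ Fin p → ℝ}
    (hmin : ∀ θ', objectiveY T X M Y lam w θ ≤ objectiveY T X M Y lam w θ') (d : Fin p → ℝ) :
    quadLoss (Dᵀ * D) (Dᵀ *ᵥ ε) (fun j => lam / w j) β (betaPart θ - β) ≤
      quadLoss (Dᵀ * D) (Dᵀ *ᵥ ε) (fun j => lam / w j) β d := by
  obtain ⟨dh, hdh⟩ : ∃ dh, dh = betaPart θ - β := ⟨_, rfl⟩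
  rw [← hdh]
  obtain ⟨δ, hδ⟩ : ∃ δ, δ = dh - d := ⟨_, rfl⟩
  obtain ⟨τ', hτ'⟩ : ∃ τ', τ' = θ (Sum.inl (Sum.inl ())) := ⟨_, rfl⟩
  obtain ⟨ζ', hζ'⟩ : ∃ ζ' : Fin q → ℝ, ζ' = fun k => θ (Sum.inl (Sum.inr k)) := ⟨_, rfl⟩
  -- Moving `β` by `-δ` adds `M *ᵥ δ` to the residual. Since `M` and `D` differ by combinations of
  -- `T` and the columns of `X`, the shifts of the other two blocks reduce this change to exactly `D
  -- *ᵥ δ`.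
  set θ' : (Unit ⊕ Fin q) ⊕ Fin p → ℝ := Sum.elim (Sum.elim
    (fun _ => τ' + (α ⬝ᵥ δ + c ⬝ᵥ δ)) (ζ' + (ζM *ᵥ δ + B *ᵥ δ))) (β + d) with hθ'
  have hdesign : ∀ ψ : (Unit ⊕ Fin q) ⊕ Fin p → ℝ, designY T X M *ᵥ ψ =
      ψ (Sum.inl (Sum.inl ())) • T + X *ᵥ (fun k => ψ (Sum.inl (Sum.inr k))) +
        M *ᵥ betaPart ψ := by
    intro ψ
    ext i
    simp [designY, designM, mulVec, dotProduct, Fintype.sum_sum_type, betaPart, mul_comm (T i)]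
  obtain ⟨r, hr⟩ : ∃ r, r = Y - designY T X M *ᵥ θ := ⟨_, rfl⟩
  have hβ : betaPart θ = β + dh := by rw [hdh]; abel
  have hvT : ∀ u : Fin p → ℝ, vecMulVec T α *ᵥ u = (α ⬝ᵥ u) • T := by
    intro u
    ext i
    simp [vecMulVec_apply, mulVec, dotProduct, Finset.sum_mul]
    exact Finset.sum_congr rfl fun _ _ => by ring
  have hvT' : ∀ u : Fin p → ℝ, vecMulVec T c *ᵥ u = (c ⬝ᵥ u) • T := by
    intro u
    ext i
    simp [vecMulVec_apply, mulVec, dotProduct, Finset.sum_mul]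
    exact Finset.sum_congr rfl fun _ _ => by ring
  have hr' : Y - designY T X M *ᵥ θ' = r + D *ᵥ δ := by
    rw [hr, hdesign, hdesign, ← hτ', ← hζ']
    have e1 : betaPart θ' = betaPart θ - δ := by
      rw [hβ, hδ]
      ext j
      simp only [θ', betaPart, Sum.elim_inr, Pi.add_apply, Pi.sub_apply]
      ring
    have e2 : (fun k => θ' (Sum.inl (Sum.inr k))) = ζ' + (ζM *ᵥ δ + B *ᵥ δ) := rfl
    have e3 : θ' (Sum.inl (Sum.inl ())) = τ' + (α ⬝ᵥ δ + c ⬝ᵥ δ) := rfl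
    rw [e1, e2, e3, mulVec_sub, hD, sub_mulVec, sub_mulVec, hvT']
    have e4 : M *ᵥ δ = (α ⬝ᵥ δ) • T + X *ᵥ (ζM *ᵥ δ) + E *ᵥ δ := by
      rw [hM, add_mulVec, add_mulVec, hvT, mulVec_mulVec]
    rw [e4, mulVec_add, mulVec_add, ← mulVec_mulVec, add_smul, add_smul]
    abel
  -- `Dᵀ` annihilates `T` and `X`, so the fitted unpenalized coefficients drop out and no optimality
  -- condition for them is needed.
  have hDr : Dᵀ *ᵥ r = Dᵀ *ᵥ ε - (Dᵀ * D) *ᵥ dh := by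
    have e5 : r = ε + ((τ - τ') • T - (α ⬝ᵥ dh) • T) + (X *ᵥ (ζY - ζ') - X *ᵥ (ζM *ᵥ dh)) -
        E *ᵥ dh := by
      have e4 : M *ᵥ dh = (α ⬝ᵥ dh) • T + X *ᵥ (ζM *ᵥ dh) + E *ᵥ dh := by
        rw [hM, add_mulVec, add_mulVec, hvT, mulVec_mulVec]
      rw [hr, hY, hdesign, hβ, ← hτ', ← hζ', mulVec_add M, e4, sub_smul, mulVec_sub X]
      abel
    have e6 : Dᵀ * D = Dᵀ * E := by
      nth_rw 2 [hD]
      rw [Matrix.mul_sub, Matrix.mul_sub, ← Matrix.mul_assoc, hDX, Matrix.zero_mul, sub_zero,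
        mul_vecMulVec, hDT, zero_vecMulVec, sub_zero]
    rw [e5, e6, mulVec_sub, mulVec_add, mulVec_add, mulVec_sub, mulVec_sub]
    simp only [mulVec_smul, hDT, smul_zero, mulVec_mulVec, hDX, Matrix.zero_mul, zero_mulVec,
      ← Matrix.mul_assoc]
    abel
  have hmain := hmin θ'
  unfold objectiveY at hmain
  rw [hr', ← hr, sum_sq_eq_dotProduct, sum_sq_eq_dotProduct] at hmain
  have hsq : (r + D *ᵥ δ) ⬝ᵥ (r + D *ᵥ δ) = r ⬝ᵥ r +
      (2 * (δ ⬝ᵥ Dᵀ *ᵥ ε) - 2 * (δ ⬝ᵥ (Dᵀ * D) *ᵥ dh) + δ ⬝ᵥ (Dᵀ * D) *ᵥ δ) := by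
    have e7 : (D *ᵥ δ) ⬝ᵥ r = δ ⬝ᵥ Dᵀ *ᵥ r := by
      rw [dotProduct_mulVec, vecMul_transpose]
    have e8 : (D *ᵥ δ) ⬝ᵥ (D *ᵥ δ) = δ ⬝ᵥ (Dᵀ * D) *ᵥ δ := by
      rw [← mulVec_mulVec, dotProduct_mulVec δ, vecMul_transpose]
    rw [add_dotProduct, dotProduct_add, dotProduct_add, e8, dotProduct_comm r (D *ᵥ δ), e7, hDr,
      dotProduct_sub]
    ring
  have hsym : (Dᵀ * D)ᵀ = Dᵀ * D := by rw [transpose_mul, transpose_transpose]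
  have hquad := quad_sub hsym dh d
  rw [← hδ] at hquad
  have hpen : ∀ b : Fin p → ℝ, lam * ∑ j, |b j| / w j = ∑ j, lam / w j * |b j| := by
    intro b
    rw [Finset.mul_sum]
    exact Finset.sum_congr rfl fun j _ => by ring
  have e9 : δ ⬝ᵥ Dᵀ *ᵥ ε = (Dᵀ *ᵥ ε) ⬝ᵥ dh - (Dᵀ *ᵥ ε) ⬝ᵥ d := by
    rw [hδ, dotProduct_comm, dotProduct_sub]
  have e10 : betaPart θ' = β + d := rfl
  rw [hsq, hpen, hpen, e9, hβ, e10] at hmain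
  simp only [Pi.add_apply] at hmain
  unfold quadLoss
  linarith

theorem frobSq_add_vecMulVec {n p : ℕ} (A : Matrix (Fin n) (Fin p) ℝ) (R : Fin n → ℝ)
    (δ : Fin p → ℝ) : frobSq (A + vecMulVec R δ) =
      frobSq A + 2 * (δ ⬝ᵥ Aᵀ *ᵥ R) + (R ⬝ᵥ R) * (δ ⬝ᵥ δ) := by
  unfold frobSq
  rw [transpose_add, Matrix.add_mul, Matrix.mul_add, Matrix.mul_add, trace_add, trace_add,
    trace_add, transpose_vecMulVec, vecMulVec_mul_vecMulVec, mul_vecMulVec, vecMulVec_mul,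
    trace_vecMulVec, trace_vecMulVec, ← mulVec_transpose, trace_vecMulVec, dotProduct_smul,
    dotProduct_comm (Aᵀ *ᵥ R)]
  simp only [smul_eq_mul]
  ring

/-- Profiling out the unpenalized coefficients of the mediator model. -/
theorem quadLoss_le_of_objectiveM_minimal {n p q : ℕ} {T R : Fin n → ℝ}
    {X : Matrix (Fin n) (Fin q) ℝ} {M E : Matrix (Fin n) (Fin p) ℝ} {α : Fin p → ℝ}
    {ζM : Matrix (Fin q) (Fin p) ℝ} (hM : M = vecMulVec T α + X * ζM + E)
    {b : Fin q → ℝ} (hR : R = T - X *ᵥ b) (hRX : Xᵀ *ᵥ R = 0) {lam : ℝ} {w : Fin p → ℝ}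
    {θ : Matrix (Unit ⊕ Fin q) (Fin p) ℝ}
    (hmin : ∀ θ', objectiveM T X M lam w θ ≤ objectiveM T X M lam w θ') (d : Fin p → ℝ) :
    quadLoss ((R ⬝ᵥ R) • 1) (Eᵀ *ᵥ R) (fun j => lam / w j) α (alphaPart θ - α) ≤
      quadLoss ((R ⬝ᵥ R) • 1) (Eᵀ *ᵥ R) (fun j => lam / w j) α d := by
  obtain ⟨dh, hdh⟩ : ∃ dh, dh = alphaPart θ - α := ⟨_, rfl⟩
  rw [← hdh]
  obtain ⟨δ, hδ⟩ : ∃ δ, δ = dh - d := ⟨_, rfl⟩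
  set ζ' : Matrix (Fin q) (Fin p) ℝ := fun k => θ (Sum.inr k) with hζ'
  -- The shift `vecMulVec b δ` replaces `T` by `R = T - X *ᵥ b` in the change of the residual
  -- matrix, which becomes `vecMulVec R δ`.
  set θ' : Matrix (Unit ⊕ Fin q) (Fin p) ℝ :=
    Matrix.fromRows (Matrix.replicateRow Unit (α + d)) (ζ' + vecMulVec b δ) with hθ'
  have hdesign : ∀ (a : Fin p → ℝ) (z : Matrix (Fin q) (Fin p) ℝ),
      designM T X * Matrix.fromRows (Matrix.replicateRow Unit a) z = vecMulVec T a + X * z := by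
    intro a z
    rw [designM, fromCols_mul_fromRows]
    congr 1
    ext i j
    simp [Matrix.mul_apply, vecMulVec_apply]
  have hθ : θ = Matrix.fromRows (Matrix.replicateRow Unit (alphaPart θ)) ζ' := by
    ext i j
    rcases i with i | i <;> rfl
  have hα : alphaPart θ = α + dh := by rw [hdh]; abel
  set A := M - designM T X * θ with hA
  have hA' : M - designM T X * θ' = A + vecMulVec R δ := by
    have e1 : α + d = alphaPart θ - δ := by rw [hα, hδ]; abel
    rw [hA, hθ, hθ', hdesign, hdesign, hR, e1, Matrix.mul_add, mul_vecMulVec, vecMulVec_sub,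
      sub_vecMulVec]
    abel
  have hTR : T ⬝ᵥ R = R ⬝ᵥ R := by
    have : T = R + X *ᵥ b := by rw [hR]; abel
    nth_rw 1 [this]
    rw [add_dotProduct, ← vecMul_transpose, ← dotProduct_mulVec, hRX, dotProduct_zero, add_zero]
  have hAR : Aᵀ *ᵥ R = Eᵀ *ᵥ R - (R ⬝ᵥ R) • dh := by
    have e2 : A = E - vecMulVec T dh + X * (ζM - ζ') := by
      rw [hA, hθ, hdesign, hM, hα, Matrix.mul_sub, vecMulVec_add]
      abel
    rw [e2, transpose_add, transpose_sub, add_mulVec, sub_mulVec, transpose_mul, ← mulVec_mulVec,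
      hRX, mulVec_zero, add_zero, transpose_vecMulVec, vecMulVec_mulVec, hTR,
      op_smul_eq_smul]
  have hmain := hmin θ'
  unfold objectiveM at hmain
  rw [hA', frobSq_add_vecMulVec, hAR] at hmain
  have hpen : ∀ b : Fin p → ℝ, lam * ∑ j, |b j| / w j = ∑ j, lam / w j * |b j| := by
    intro b
    rw [Finset.mul_sum]
    exact Finset.sum_congr rfl fun j _ => by ring
  have e3 : alphaPart θ' = α + d := rfl
  have e4 : δ ⬝ᵥ (Eᵀ *ᵥ R) = (Eᵀ *ᵥ R) ⬝ᵥ dh - (Eᵀ *ᵥ R) ⬝ᵥ d := by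
    rw [hδ, dotProduct_comm, dotProduct_sub]
  have hquad := quad_sub (p := p) transpose_one dh d
  rw [← hδ] at hquad
  simp only [one_mulVec] at hquad
  rw [hpen, hpen, e3, hα, dotProduct_sub, e4, dotProduct_smul, smul_eq_mul] at hmain
  simp only [Pi.add_apply] at hmain
  unfold quadLoss
  simp only [smul_mulVec, one_mulVec, dotProduct_smul, smul_eq_mul]
  have hquad' := congrArg (fun z => (R ⬝ᵥ R) * z) hquad
  simp only [mul_sub] at hquad'
  linarith

end Deterministic

/-! ### Consistency and selection for penalized quadratic losses. -/

section Asymptotics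

/-- The quadratic forms of matrices close to a positive definite matrix are uniformly coercive. -/
theorem exists_eventually_mul_sum_sq_le {p : ℕ} {S : Matrix (Fin p) (Fin p) ℝ} (hS : S.PosDef) :
    ∃ c : ℝ, 0 < c ∧ ∀ᶠ A in 𝓝 S, ∀ d : Fin p → ℝ, c * ∑ j, d j ^ 2 ≤ d ⬝ᵥ A *ᵥ d := by
  have hcomp : IsCompact (Metric.sphere (0 : Fin p → ℝ) 1) := isCompact_sphere 0 1
  have hcont : Continuous fun z : Matrix (Fin p) (Fin p) ℝ × (Fin p → ℝ) =>
      z.2 ⬝ᵥ z.1 *ᵥ z.2 :=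
    continuous_snd.dotProduct (continuous_fst.matrix_mulVec continuous_snd)
  obtain ⟨c, hc, hle⟩ := hcomp.exists_forall_le' (f := fun d => d ⬝ᵥ S *ᵥ d) (a := 0)
    (hcont.comp (by fun_prop : Continuous fun d : Fin p → ℝ => (S, d))).continuousOn (by
      intro d hd
      have hd0 : d ≠ 0 := ne_zero_of_mem_unit_sphere ⟨d, hd⟩
      simpa using hS.dotProduct_mulVec_pos hd0)
  -- Half of the minimum over the unit sphere survives a small perturbation of the matrix, uniformly
  -- by compactness. The sphere is that of the sup norm, so a factor `p` is lost; `p + 1` keeps the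
  -- denominator positive when `p = 0`.
  refine ⟨c / 2 / (p + 1), by positivity, ?_⟩
  have hev := hcomp.eventually_forall_of_forall_eventually (x₀ := S)
    (P := fun A d => c / 2 < d ⬝ᵥ A *ᵥ d) (by
      intro d hd
      refine hcont.continuousAt.eventually_const_lt ?_
      have := hle d hd
      dsimp only
      linarith)
  filter_upwards [hev] with A hA d
  rcases eq_or_ne d 0 with rfl | hd
  · simp
  have hnorm : 0 < ‖d‖ := norm_pos_iff.mpr hd
  have h1 := hA (‖d‖⁻¹ • d) (by simp [norm_smul, hnorm.ne'])
  rw [mulVec_smul, dotProduct_smul, smul_dotProduct, smul_eq_mul, smul_eq_mul] at h1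
  have h2 : c / 2 * ‖d‖ ^ 2 ≤ d ⬝ᵥ A *ᵥ d := by
    have h3 := mul_lt_mul_of_pos_right h1 (by positivity : 0 < ‖d‖ ^ 2)
    have h4 : ‖d‖⁻¹ * (‖d‖⁻¹ * d ⬝ᵥ A *ᵥ d) * ‖d‖ ^ 2 = d ⬝ᵥ A *ᵥ d := by
      field_simp
    linarith
  refine le_trans ?_ h2
  have h5 : ∑ j, d j ^ 2 ≤ (p + 1) * ‖d‖ ^ 2 := by
    calc ∑ j, d j ^ 2 ≤ ∑ _j : Fin p, ‖d‖ ^ 2 := by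
          refine Finset.sum_le_sum fun j _ => ?_
          rw [← sq_abs]
          exact pow_le_pow_left₀ (abs_nonneg _) (norm_le_pi_norm d j) 2
      _ = p * ‖d‖ ^ 2 := by simp
      _ ≤ (p + 1) * ‖d‖ ^ 2 := by nlinarith [sq_nonneg ‖d‖]
  calc c / 2 / (p + 1) * ∑ j, d j ^ 2 ≤ c / 2 / (p + 1) * ((p + 1) * ‖d‖ ^ 2) :=
        mul_le_mul_of_nonneg_left h5 (by positivity)
    _ = c / 2 * ‖d‖ ^ 2 := by field_simp

variable {Ω : Type*} [MeasurableSpace Ω] {μ : Measure Ω}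

/-- Consistency and selection for minimizers of penalized quadratic losses: if the Gram matrix is
of order `n`, the score of order `√n`, and the penalties are `O_p(√n)` on the support of `b` and
of larger order than `√n` off the support, then `b + d` is consistent for `b` and vanishes where
`b` does. -/
theorem tendsto_and_eventually_eq_zero_of_quadLoss_minimal {p : ℕ}
    {G : ℝ × ℕ × Ω → Matrix (Fin p) (Fin p) ℝ} {S : Matrix (Fin p) (Fin p) ℝ}
    {g pen d : ℝ × ℕ × Ω → Fin p → ℝ} {b : Fin p → ℝ} (hS : S.PosDef)
    (hsymm : ∀ x, (G x)ᵀ = G x)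
    (hG : ∀ j k, Tendsto (fun x => G x j k / (x.2.1 : ℝ)) (tightFilter μ) (𝓝 (S j k)))
    (hg : ∀ j, IsTight μ fun x => g x j / √(x.2.1 : ℝ))
    (hpen : ∀ᶠ x in tightFilter μ, ∀ j, 0 ≤ pen x j)
    (hsupp : ∀ j, b j ≠ 0 → IsTight μ fun x => pen x j / √(x.2.1 : ℝ))
    (hzero : ∀ j, b j = 0 → ∀ f : ℝ → ℝ,
      ∀ᶠ x in tightFilter μ, f x.1 < pen x j / √(x.2.1 : ℝ))
    (hmin : ∀ᶠ x in tightFilter μ, ∀ d',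
      quadLoss (G x) (g x) (pen x) b (d x) ≤ quadLoss (G x) (g x) (pen x) b d') :
    (∀ j, Tendsto (fun x => d x j) (tightFilter μ) (𝓝 0)) ∧
      ∀ᶠ x in tightFilter μ, ∀ j, b j = 0 → d x j = 0 := by
  classical
  obtain ⟨c, hc, hcoer⟩ := exists_eventually_mul_sum_sq_le hS
  have hGt : Tendsto (fun x : ℝ × ℕ × Ω => ((x.2.1 : ℝ)⁻¹ • G x)) (tightFilter μ) (𝓝 S) := by
    refine tendsto_pi_nhds.2 fun j => tendsto_pi_nhds.2 fun k => ?_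
    refine (hG j k).congr fun x => ?_
    rw [Matrix.smul_apply, smul_eq_mul, div_eq_inv_mul]
  have hcoer' := hGt.eventually hcoer
  have hposn : ∀ᶠ x : ℝ × ℕ × Ω in tightFilter μ, (0 : ℝ) < x.2.1 := by
    filter_upwards [tendsto_index.eventually_gt_atTop 0] with x hx
    exact_mod_cast hx
  -- A tight quantity that serves as the `H` of `mul_sum_sq_le_of_quadLoss_le_zero`; it sees the
  -- penalties only on the support of `b`.
  set H : ℝ × ℕ × Ω → ℝ := fun x => ∑ j, (2 * |g x j / √(x.2.1 : ℝ)| +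
    if b j = 0 then 0 else |pen x j / √(x.2.1 : ℝ)|) with hH
  have hHt : IsTight μ H := by
    refine IsTight.sum _ fun j => ((isTight_const 2).mul (hg j).abs).add ?_
    by_cases hb : b j = 0
    · simpa [hb] using isTight_const (μ := μ) 0
    · simpa [hb] using (hsupp j hb).abs
  have hdt : ∀ j, IsTight μ fun x => √(x.2.1 : ℝ) * d x j := by
    intro j
    refine ((isTight_const 1).add
      ((isTight_const (p / c ^ 2)).mul (hHt.mul hHt))).of_abs_le ?_
    filter_upwards [hcoer', hposn, hpen, hmin] with x hx hn hp hm
    have hsn : 0 < √(x.2.1 : ℝ) := Real.sqrt_pos.mpr hn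
    have h1 := mul_sum_sq_le_of_quadLoss_le_zero (hm 0) hp hc (n := x.2.1) (H := H x) (by
        have h2 := hx (d x)
        rw [smul_mulVec, dotProduct_smul, smul_eq_mul] at h2
        have h3 := mul_le_mul_of_nonneg_left h2 hn.le
        rw [← mul_assoc, ← mul_assoc, mul_inv_cancel₀ hn.ne', one_mul, mul_comm _ c] at h3
        exact h3) hn.le (by
        intro k
        rw [← div_le_iff₀ hsn]
        refine le_trans (le_of_eq ?_) (Finset.single_le_sum (f := fun j =>
          2 * |g x j / √(x.2.1 : ℝ)| + if b j = 0 then 0 else |pen x j / √(x.2.1 : ℝ)|)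
          (fun j _ => ?_) (Finset.mem_univ k))
        · rw [abs_div, abs_div, abs_of_pos hsn, abs_of_nonneg (hp k)]
          split_ifs <;> ring
        · split_ifs <;> positivity)
    have h4 : (√(x.2.1 : ℝ) * d x j) ^ 2 ≤ p / c ^ 2 * (H x * H x) := by
      calc (√(x.2.1 : ℝ) * d x j) ^ 2 = x.2.1 * d x j ^ 2 := by
            rw [mul_pow, Real.sq_sqrt hn.le]
        _ ≤ x.2.1 * ∑ j, d x j ^ 2 :=
            mul_le_mul_of_nonneg_left (Finset.single_le_sum (f := fun j => d x j ^ 2)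
              (fun _ _ => sq_nonneg _) (Finset.mem_univ j)) hn.le
        _ ≤ _ := h1
        _ = p / c ^ 2 * (H x * H x) := by ring
    have h5 : |√(x.2.1 : ℝ) * d x j| ≤ 1 + (√(x.2.1 : ℝ) * d x j) ^ 2 := by
      rw [← sq_abs (√(x.2.1 : ℝ) * d x j)]
      nlinarith [sq_nonneg (|√(x.2.1 : ℝ) * d x j| - 1), abs_nonneg (√(x.2.1 : ℝ) * d x j)]
    linarith
  refine ⟨fun j => ?_, ?_⟩
  · have h0 : Tendsto (fun n : ℕ => (√(n : ℝ))⁻¹) atTop (𝓝 0) :=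
      (Real.tendsto_sqrt_atTop.comp tendsto_natCast_atTop_atTop).inv_tendsto_atTop
    refine ((hdt j).tendsto_zero h0).congr' ?_
    filter_upwards [hposn] with x hn
    rw [← mul_assoc, inv_mul_cancel₀ (Real.sqrt_pos.mpr hn).ne', one_mul]
  · rw [eventually_all]
    intro j
    by_cases hb : b j = 0
    swap
    · exact Eventually.of_forall fun x h => absurd h hb
    have hGtight : ∀ k, IsTight μ fun x => G x j k / (x.2.1 : ℝ) :=
      fun k => isTight_of_tendsto (hG j k)
    -- `f` bounds the left side of `hlarge` divided by `√n`, using `d = O_p(n^(-1/2))`; `hzero`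
    -- supplies a penalty above this very function of `K`.
    obtain ⟨f, hf⟩ := (((isTight_const 2).mul (IsTight.sum Finset.univ fun k =>
      (hGtight k).abs.mul (hdt k).abs)).add ((hdt j).abs.mul (hGtight j).abs)).add
      ((isTight_const 2).mul (hg j).abs)
    filter_upwards [hf, hzero j hb f, hmin, hposn] with x hx hz hm hn _
    refine eq_zero_of_quadLoss_minimal (hsymm x) hm hb ?_
    have hsn : 0 < √(x.2.1 : ℝ) := Real.sqrt_pos.mpr hn
    have h1 := ((le_abs_self _).trans hx).trans_lt hz
    rw [lt_div_iff₀ hsn] at h1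
    refine lt_of_eq_of_lt ?_ h1
    have h2 : ∀ k l, |G x j k / (x.2.1 : ℝ)| * |√(x.2.1 : ℝ) * d x l| * √(x.2.1 : ℝ) =
        |G x j k| * |d x l| := by
      intro k l
      rw [abs_div, abs_mul, abs_of_pos hn, abs_of_pos hsn]
      have h3 : √(x.2.1 : ℝ) * √(x.2.1 : ℝ) = x.2.1 := Real.mul_self_sqrt hn.le
      calc |G x j k| / (x.2.1 : ℝ) * (√(x.2.1 : ℝ) * |d x l|) * √(x.2.1 : ℝ)
          = |G x j k| * |d x l| * ((√(x.2.1 : ℝ) * √(x.2.1 : ℝ)) / x.2.1) := by ring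
        _ = |G x j k| * |d x l| := by rw [h3, div_self hn.ne', mul_one]
    rw [add_mul, add_mul, mul_assoc 2, Finset.sum_mul, mul_comm (|√(x.2.1 : ℝ) * d x j|), h2]
    simp only [h2]
    rw [mul_assoc 2, abs_div, abs_of_pos hsn, div_mul_cancel₀ _ hsn.ne', mul_comm (|G x j j|)]

end Asymptotics

/-! ### Projection off the covariates and off the treatment. -/

section Projection

variable {n q : ℕ} {X : Matrix (Fin n) (Fin q) ℝ}

theorem projPerp_mulVec (X : Matrix (Fin n) (Fin q) ℝ) (v : Fin n → ℝ) :
    projPerp X *ᵥ v = v - X *ᵥ ((Xᵀ * X)⁻¹ *ᵥ (Xᵀ *ᵥ v)) := by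
  rw [projPerp, sub_mulVec, one_mulVec, ← mulVec_mulVec, ← mulVec_mulVec]

theorem transpose_mulVec_projPerp (hX : IsUnit (Xᵀ * X).det) (v : Fin n → ℝ) :
    Xᵀ *ᵥ (projPerp X *ᵥ v) = 0 := by
  rw [projPerp_mulVec, mulVec_sub, mulVec_mulVec, mulVec_mulVec, mul_nonsing_inv _ hX,
    one_mulVec, sub_self]

theorem mulVec_dotProduct_eq (A : Matrix (Fin n) (Fin q) ℝ) (u : Fin q → ℝ) (v : Fin n → ℝ) :
    (A *ᵥ u) ⬝ᵥ v = u ⬝ᵥ (Aᵀ *ᵥ v) := by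
  rw [dotProduct_mulVec, vecMul_transpose]

/-- The projection of `v` onto the orthogonal complement of `T` and the columns of `X`. -/
noncomputable def residual (T : Fin n → ℝ) (X : Matrix (Fin n) (Fin q) ℝ) (v : Fin n → ℝ) :
    Fin n → ℝ :=
  projPerp X *ᵥ v - ((projPerp X *ᵥ T) ⬝ᵥ v / ((projPerp X *ᵥ T) ⬝ᵥ (projPerp X *ᵥ T))) •
    (projPerp X *ᵥ T)

/-- Supplies the coefficients `c` and `B` for eliminating `T` and `X` from the outcome model. -/
theorem exists_residual_eq (T : Fin n → ℝ) (X : Matrix (Fin n) (Fin q) ℝ) (v : Fin n → ℝ) :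
    ∃ (c : ℝ) (b : Fin q → ℝ), residual T X v = v - c • T - X *ᵥ b := by
  refine ⟨(projPerp X *ᵥ T) ⬝ᵥ v / ((projPerp X *ᵥ T) ⬝ᵥ (projPerp X *ᵥ T)),
    (Xᵀ * X)⁻¹ *ᵥ (Xᵀ *ᵥ v) - ((projPerp X *ᵥ T) ⬝ᵥ v / ((projPerp X *ᵥ T) ⬝ᵥ
      (projPerp X *ᵥ T))) • ((Xᵀ * X)⁻¹ *ᵥ (Xᵀ *ᵥ T)), ?_⟩
  rw [residual]
  generalize (projPerp X *ᵥ T) ⬝ᵥ v / ((projPerp X *ᵥ T) ⬝ᵥ (projPerp X *ᵥ T)) = c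
  rw [projPerp_mulVec, projPerp_mulVec, mulVec_sub, mulVec_smul, smul_sub]
  abel

theorem transpose_mulVec_residual (hX : IsUnit (Xᵀ * X).det) (T v : Fin n → ℝ) :
    Xᵀ *ᵥ residual T X v = 0 := by
  rw [residual, mulVec_sub, mulVec_smul, transpose_mulVec_projPerp hX,
    transpose_mulVec_projPerp hX, smul_zero, sub_zero]

theorem projPerp_dotProduct_projPerp (hX : IsUnit (Xᵀ * X).det) (u v : Fin n → ℝ) :
    (projPerp X *ᵥ u) ⬝ᵥ (projPerp X *ᵥ v) = (projPerp X *ᵥ u) ⬝ᵥ v := by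
  rw [projPerp_mulVec X v, dotProduct_sub, dotProduct_comm _ (X *ᵥ _), mulVec_dotProduct_eq X,
    transpose_mulVec_projPerp hX, dotProduct_zero, sub_zero]

theorem dotProduct_projPerp (hX : IsUnit (Xᵀ * X).det) (u v : Fin n → ℝ) :
    u ⬝ᵥ (projPerp X *ᵥ v) = (projPerp X *ᵥ u) ⬝ᵥ v := by
  rw [← projPerp_dotProduct_projPerp hX u v, dotProduct_comm (projPerp X *ᵥ u),
    projPerp_dotProduct_projPerp hX, dotProduct_comm]

theorem dotProduct_residual (hX : IsUnit (Xᵀ * X).det) {T : Fin n → ℝ}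
    (hT : (projPerp X *ᵥ T) ⬝ᵥ (projPerp X *ᵥ T) ≠ 0) (v : Fin n → ℝ) :
    T ⬝ᵥ residual T X v = 0 := by
  rw [residual, dotProduct_sub, dotProduct_smul, dotProduct_projPerp hX,
    dotProduct_projPerp hX T T, ← projPerp_dotProduct_projPerp hX T T, smul_eq_mul,
    div_mul_cancel₀ _ hT, sub_self]

/-- Each correction to `v ⬝ᵥ w` is a product of scores of `v` and of `w`, hence negligible when both
are centered errors. -/
theorem residual_dotProduct (T : Fin n → ℝ) (X : Matrix (Fin n) (Fin q) ℝ) (v w : Fin n → ℝ) :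
    residual T X v ⬝ᵥ w = v ⬝ᵥ w - ((Xᵀ * X)⁻¹ *ᵥ (Xᵀ *ᵥ v)) ⬝ᵥ (Xᵀ *ᵥ w) -
      (projPerp X *ᵥ T) ⬝ᵥ v * ((projPerp X *ᵥ T) ⬝ᵥ w) /
        ((projPerp X *ᵥ T) ⬝ᵥ (projPerp X *ᵥ T)) := by
  rw [residual, sub_dotProduct, smul_dotProduct, projPerp_mulVec X v, sub_dotProduct,
    mulVec_dotProduct_eq, smul_eq_mul]
  ring

theorem residual_dotProduct_residual (hX : IsUnit (Xᵀ * X).det) {T : Fin n → ℝ}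
    (hT : (projPerp X *ᵥ T) ⬝ᵥ (projPerp X *ᵥ T) ≠ 0) (v w : Fin n → ℝ) :
    residual T X v ⬝ᵥ residual T X w = residual T X v ⬝ᵥ w := by
  obtain ⟨c, b, h⟩ := exists_residual_eq T X w
  rw [h, dotProduct_sub, dotProduct_sub, dotProduct_smul, dotProduct_comm _ T,
    dotProduct_residual hX hT, dotProduct_comm _ (X *ᵥ b), mulVec_dotProduct_eq,
    transpose_mulVec_residual hX]
  simp

end Projection

/-! ### Measurability of the projected treatment as a function of the covariates. -/

section MatrixMeasurability

variable {Z : Type*} [MeasurableSpace Z] {q : ℕ}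

theorem measurable_det {A : Z → Matrix (Fin q) (Fin q) ℝ}
    (hA : ∀ i j, Measurable fun z => A z i j) : Measurable fun z => (A z).det := by
  simp only [Matrix.det_apply]
  exact Finset.measurable_fun_sum _ fun σ _ =>
    (Finset.measurable_fun_prod _ fun i _ => hA _ _).const_smul _

/-- By the adjugate formula. Singular matrices need no separate case, because real inversion with
`0⁻¹ = 0` is measurable. -/
theorem measurable_inv_apply {A : Z → Matrix (Fin q) (Fin q) ℝ}
    (hA : ∀ i j, Measurable fun z => A z i j) (i j : Fin q) :
    Measurable fun z => (A z)⁻¹ i j := by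
  simp only [Matrix.inv_def, Ring.inverse_eq_inv', Matrix.smul_apply, smul_eq_mul,
    Matrix.adjugate_apply]
  refine (measurable_det hA).inv.mul (measurable_det fun k l => ?_)
  simp only [Matrix.updateRow_apply]
  split_ifs
  · exact measurable_const
  · exact hA k l

theorem measurable_projPerp_mulVec {n : ℕ} {A : Z → Matrix (Fin n) (Fin q) ℝ}
    {v : Z → Fin n → ℝ} (hA : ∀ i j, Measurable fun z => A z i j)
    (hv : ∀ i, Measurable fun z => v z i) : Measurable fun z => projPerp (A z) *ᵥ v z := by
  have h0 : ∀ i j, Measurable fun z => ((A z)ᵀ * A z) i j := by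
    intro i j
    simp only [Matrix.mul_apply, transpose_apply]
    exact Finset.measurable_fun_sum _ fun k _ => (hA k i).mul (hA k j)
  refine measurable_pi_lambda _ fun i => ?_
  simp only [projPerp_mulVec]
  simp only [Pi.sub_apply, mulVec, dotProduct]
  exact (hv i).sub (Finset.measurable_fun_sum _ fun k _ => (hA i k).mul
    (Finset.measurable_fun_sum _ fun l _ => (measurable_inv_apply h0 k l).mul
      (Finset.measurable_fun_sum _ fun m _ => (hA m l).mul (hv m))))

end MatrixMeasurability

/-! ### Limits of the Gram matrices and orders of the scores. -/

section Scores

variable {Ω : Type*} [MeasurableSpace Ω] {μ : Measure Ω} {p q : ℕ}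
  {T : ℕ → Ω → ℝ} {X : ℕ → Ω → Fin q → ℝ} {M : ℕ → Ω → Fin p → ℝ} {Y : ℕ → Ω → ℝ}
  {E : ℕ → Ω → Fin p → ℝ} {ε : ℕ → Ω → ℝ} {α β : Fin p → ℝ} {τ : ℝ}
  {ζM : Matrix (Fin q) (Fin p) ℝ} {ζY : Fin q → ℝ}
  {covE : Matrix (Fin p) (Fin p) ℝ} {varε : ℝ} {covX : Matrix (Fin q) (Fin q) ℝ} {varT : ℝ}

/-- Weighted sums of a centered square integrable function of the errors, with weights depending
on the covariates, are `O_p(√n)` if the sum of the squared weights is `O_p(n)`. -/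
theorem IsLinearSEM.isTight_sum_mul [IsProbabilityMeasure μ] [NeZero q]
    (h : IsLinearSEM μ T X M Y E ε α β τ ζM ζY)
    {φ : (Fin p → ℝ) × ℝ → ℝ} (hφ : Measurable φ)
    (hL : MemLp (fun ω => φ (E 0 ω, ε 0 ω)) 2 μ) (hmean : ∫ ω, φ (E 0 ω, ε 0 ω) ∂μ = 0)
    {ψ : ∀ n : ℕ, (ℕ → ℝ × (Fin q → ℝ)) → Fin n → ℝ} (hψ : ∀ n, Measurable (ψ n))
    (ht : IsTight μ fun x => (∑ i, ψ x.2.1 (fun i => (T i x.2.2, X i x.2.2)) i ^ 2) /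
      (x.2.1 : ℝ)) :
    IsTight μ fun x => (∑ i : Fin x.2.1, ψ x.2.1 (fun i => (T i x.2.2, X i x.2.2)) i *
      φ (E i x.2.2, ε i x.2.2)) / √(x.2.1 : ℝ) := by
  obtain ⟨h1, h2⟩ := integrable_mul_and_integral_mul
    (U := fun i ω => φ (E i ω, ε i ω)) hL hmean
    (fun i k hik => (h.errors_iIndep.indepFun hik).comp hφ hφ)
    (fun i => (h.errors_identDistrib i).comp hφ)
  have hZ : Measurable fun ω (i : ℕ) => (T i ω, X i ω) :=
    measurable_pi_lambda _ fun i => (h.measurable_T i).prodMk (h.measurable_X i)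
  refine JointAdaptivePenalty.isTight_sum_mul (U := fun i ω => φ (E i ω, ε i ω))
    (V := fun n ω => ψ n fun i => (T i ω, X i ω)) h1 h2 (fun n => (hψ n).comp hZ) (fun n => ?_) ht
  exact h.indep_errors_covariates.comp (φ := fun e i => φ (e i)) (ψ := ψ n)
    (measurable_pi_lambda (fun (e : ℕ → (Fin p → ℝ) × ℝ) i => φ (e i)) fun i =>
      hφ.comp (measurable_pi_apply i)) (hψ n)

theorem MomentCondition.tendsto_gram (hm : MomentCondition μ T X E ε covE varε covX varT) :
    Tendsto (fun x : ℝ × ℕ × Ω => (x.2.1 : ℝ)⁻¹ •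
      ((sampleMat X x.2.1 x.2.2)ᵀ * sampleMat X x.2.1 x.2.2)) (tightFilter μ) (𝓝 covX) := by
  refine tendsto_pi_nhds.2 fun j => tendsto_pi_nhds.2 fun k => ?_
  refine (tendsto_iff_tendstoInMeasure.2 (hm.gram_X j k)).congr fun x => ?_
  rw [Matrix.smul_apply, smul_eq_mul, div_eq_inv_mul]

theorem MomentCondition.tendsto_dotProduct_residualT
    (hm : MomentCondition μ T X E ε covE varε covX varT) :
    Tendsto (fun x : ℝ × ℕ × Ω => (residualT T X x.2.1 x.2.2 ⬝ᵥ residualT T X x.2.1 x.2.2) /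
      (x.2.1 : ℝ)) (tightFilter μ) (𝓝 varT) := by
  refine (tendsto_iff_tendstoInMeasure.2 hm.norm_residualT).congr fun x => ?_
  rw [sum_sq_eq_dotProduct]

theorem MomentCondition.eventually_residualT_ne_zero
    (hm : MomentCondition μ T X E ε covE varε covX varT) :
    ∀ᶠ x : ℝ × ℕ × Ω in tightFilter μ,
      residualT T X x.2.1 x.2.2 ⬝ᵥ residualT T X x.2.1 x.2.2 ≠ 0 := by
  filter_upwards [hm.tendsto_dotProduct_residualT.eventually_const_lt hm.varT_pos] with x hx h0
  simp [h0] at hx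

theorem eventually_index_pos : ∀ᶠ x : ℝ × ℕ × Ω in tightFilter μ, (0 : ℝ) < x.2.1 := by
  filter_upwards [tendsto_index.eventually_gt_atTop 0] with x hx
  exact_mod_cast hx

theorem MomentCondition.eventually_isUnit_det
    (hm : MomentCondition μ T X E ε covE varε covX varT) :
    ∀ᶠ x : ℝ × ℕ × Ω in tightFilter μ,
      IsUnit ((sampleMat X x.2.1 x.2.2)ᵀ * sampleMat X x.2.1 x.2.2).det := by
  have h := ((continuous_id.matrix_det).tendsto covX).comp hm.tendsto_gram
  filter_upwards [h.eventually_ne hm.covX_posDef.det_pos.ne'] with x hx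
  simp only [Function.comp_apply, id_eq, det_smul] at hx
  exact isUnit_iff_ne_zero.2 (right_ne_zero_of_mul hx)

/-- Inversion is continuous at the nonsingular `covX`, and `n • A⁻¹ = (n⁻¹ • A)⁻¹`. -/
theorem MomentCondition.isTight_inv (hm : MomentCondition μ T X E ε covE varε covX varT)
    (k l : Fin q) : IsTight μ fun x : ℝ × ℕ × Ω => (x.2.1 : ℝ) *
      ((sampleMat X x.2.1 x.2.2)ᵀ * sampleMat X x.2.1 x.2.2)⁻¹ k l := by
  have hc : ContinuousAt (fun A : Matrix (Fin q) (Fin q) ℝ => A⁻¹ k l) covX := by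
    have h1 : ContinuousAt Ring.inverse covX.det := by
      rw [Ring.inverse_eq_inv']
      exact continuousAt_inv₀ hm.covX_posDef.det_pos.ne'
    have h2 := continuousAt_matrix_inv covX h1
    exact ((continuous_apply l).comp (continuous_apply k)).continuousAt.comp h2
  refine (isTight_of_tendsto (hc.tendsto.comp hm.tendsto_gram)).congr ?_
  filter_upwards [eventually_index_pos, hm.eventually_isUnit_det] with x hx hu
  have e : ∀ (c : ℝ) (A : Matrix (Fin q) (Fin q) ℝ), c ≠ 0 → IsUnit A.det →
      c * A⁻¹ k l = (c⁻¹ • A)⁻¹ k l := by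
    intro c A hc hA
    rw [Matrix.inv_eq_left_inv (A := c⁻¹ • A) (B := c • A⁻¹) (by
      rw [smul_mul_smul_comm, nonsing_inv_mul _ hA, mul_inv_cancel₀ hc, one_smul])]
    rfl
  exact e _ _ hx.ne' hu

/-- The projection removes only `O_p(1)` from inner products of vectors whose inner products with
the covariates are `O_p(√n)`. -/
theorem MomentCondition.isTight_sub_residual_dotProduct
    (hm : MomentCondition μ T X E ε covE varε covX varT) {v w : ∀ x : ℝ × ℕ × Ω, Fin x.2.1 → ℝ}
    (hXv : ∀ k, IsTight μ fun x => ((sampleMat X x.2.1 x.2.2)ᵀ *ᵥ v x) k / √(x.2.1 : ℝ))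
    (hXw : ∀ k, IsTight μ fun x => ((sampleMat X x.2.1 x.2.2)ᵀ *ᵥ w x) k / √(x.2.1 : ℝ))
    (hRv : IsTight μ fun x => (residualT T X x.2.1 x.2.2 ⬝ᵥ v x) / √(x.2.1 : ℝ))
    (hRw : IsTight μ fun x => (residualT T X x.2.1 x.2.2 ⬝ᵥ w x) / √(x.2.1 : ℝ)) :
    IsTight μ fun x => v x ⬝ᵥ w x -
      residual (sampleVec T x.2.1 x.2.2) (sampleMat X x.2.1 x.2.2) (v x) ⬝ᵥ w x := by
  have hinv : IsTight μ fun x : ℝ × ℕ × Ω =>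
      ((residualT T X x.2.1 x.2.2 ⬝ᵥ residualT T X x.2.1 x.2.2) / (x.2.1 : ℝ))⁻¹ :=
    isTight_of_tendsto (hm.tendsto_dotProduct_residualT.inv₀ hm.varT_pos.ne')
  refine ((IsTight.sum Finset.univ fun k => (IsTight.sum Finset.univ fun l =>
    (hm.isTight_inv k l).mul (hXv l)).mul (hXw k)).add ((hRv.mul hRw).mul hinv)).congr ?_
  filter_upwards [eventually_index_pos] with x hx
  have hs : √(x.2.1 : ℝ) * √(x.2.1 : ℝ) = x.2.1 := Real.mul_self_sqrt hx.le
  have hs0 : √(x.2.1 : ℝ) ≠ 0 := (Real.sqrt_pos.mpr hx).ne'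
  rw [residual_dotProduct]
  have e1 : ∀ A : Matrix (Fin q) (Fin q) ℝ, ∀ a b : Fin q → ℝ, (A *ᵥ a) ⬝ᵥ b =
      ∑ k, (∑ l, (x.2.1 : ℝ) * A k l * (a l / √(x.2.1 : ℝ))) * (b k / √(x.2.1 : ℝ)) := by
    intro A a b
    simp only [dotProduct, mulVec, Finset.sum_mul]
    refine Finset.sum_congr rfl fun k _ => Finset.sum_congr rfl fun l _ => ?_
    nth_rw 1 [← hs]
    field_simp
  rw [e1]
  have e2 : ∀ a b c : ℝ, a / √(x.2.1 : ℝ) * (b / √(x.2.1 : ℝ)) * (c / (x.2.1 : ℝ))⁻¹ =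
      a * b / c := by
    intro a b c
    rw [div_mul_div_comm, hs, inv_div]
    field_simp
  rw [e2]
  simp only [residualT]
  ring

/-- Inner products of the covariates and of the residual of `T` with a centered function of the
errors are `O_p(√n)`. -/
theorem IsLinearSEM.isTight_scores [IsProbabilityMeasure μ] [NeZero q]
    (h : IsLinearSEM μ T X M Y E ε α β τ ζM ζY)
    (hm : MomentCondition μ T X E ε covE varε covX varT)
    {φ : (Fin p → ℝ) × ℝ → ℝ} (hφ : Measurable φ)
    (hL : MemLp (fun ω => φ (E 0 ω, ε 0 ω)) 2 μ) (hmean : ∫ ω, φ (E 0 ω, ε 0 ω) ∂μ = 0) :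
    (∀ k, IsTight μ fun x : ℝ × ℕ × Ω => ((sampleMat X x.2.1 x.2.2)ᵀ *ᵥ
      fun i : Fin x.2.1 => φ (E i x.2.2, ε i x.2.2)) k / √(x.2.1 : ℝ)) ∧
    IsTight μ fun x : ℝ × ℕ × Ω => (residualT T X x.2.1 x.2.2 ⬝ᵥ
      fun i : Fin x.2.1 => φ (E i x.2.2, ε i x.2.2)) / √(x.2.1 : ℝ) := by
  constructor
  · intro k
    have ht : IsTight μ fun x : ℝ × ℕ × Ω =>
        (∑ i : Fin x.2.1, X i x.2.2 k ^ 2) / (x.2.1 : ℝ) := by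
      refine (isTight_of_tendsto (tendsto_iff_tendstoInMeasure.2 (hm.gram_X k k))).congr
        (Eventually.of_forall fun x => ?_)
      simp only [sq]
      rfl
    exact (h.isTight_sum_mul hφ hL hmean (ψ := fun n z i => (z i).2 k)
      (fun n => by fun_prop) ht).congr (Eventually.of_forall fun x => rfl)
  -- The residual of `T` is written as a measurable function of the covariate sequence alone, the
  -- form in which independence of the errors applies.
  · obtain ⟨ψ, hψ⟩ : ∃ ψ : ∀ n : ℕ, (ℕ → ℝ × (Fin q → ℝ)) → Fin n → ℝ, ∀ n z,
        ψ n z = projPerp (Matrix.of fun (i : Fin n) k => (z i).2 k) *ᵥ fun i => (z i).1 :=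
      ⟨_, fun _ _ => rfl⟩
    have hψm : ∀ n, Measurable (ψ n) := by
      intro n
      rw [funext (hψ n)]
      refine measurable_projPerp_mulVec (fun i j => ?_) (fun i => by fun_prop)
      simp only [Matrix.of_apply]
      fun_prop
    have hψR : ∀ n ω, ψ n (fun i => (T i ω, X i ω)) = residualT T X n ω := by
      intro n ω
      rw [hψ]
      rfl
    have key := h.isTight_sum_mul hφ hL hmean hψm
    simp only [hψR] at key
    refine key ((isTight_of_tendsto hm.tendsto_dotProduct_residualT).congr
      (Eventually.of_forall fun x => ?_))
    rw [sum_sq_eq_dotProduct]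

theorem IsLinearSEM.tendsto_gram_E [IsProbabilityMeasure μ] [NeZero q]
    (h : IsLinearSEM μ T X M Y E ε α β τ ζM ζY)
    (hm : MomentCondition μ T X E ε covE varε covX varT) (j k : Fin p) :
    Tendsto (fun x : ℝ × ℕ × Ω => ((fun i : Fin x.2.1 => E i x.2.2 j) ⬝ᵥ
      fun i : Fin x.2.1 => E i x.2.2 k) / (x.2.1 : ℝ)) (tightFilter μ) (𝓝 (covE j k)) := by
  have hφ : Measurable fun e : (Fin p → ℝ) × ℝ => e.1 j * e.1 k := by fun_prop
  have h1 := tendsto_sum_div (μ := μ) (U := fun i ω => E i ω j * E i ω k)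
    ((hm.memLp_E 0 j).integrable_mul (hm.memLp_E 0 k))
    (fun i k hik => (h.errors_iIndep.indepFun hik).comp hφ hφ)
    (fun i => (h.errors_identDistrib i).comp hφ)
  have h2 : ∫ ω, E 0 ω j * E 0 ω k ∂μ = covE j k := by
    rw [← hm.cov_E 0 j k, covariance_eq_sub (hm.memLp_E 0 j) (hm.memLp_E 0 k), h.mean_E, h.mean_E,
      mul_zero, sub_zero]
    rfl
  rw [h2] at h1
  exact h1

/-- Independence of `E` and `ε` makes the product centered and square integrable with second moments
only; the weights are constantly `1`. -/
theorem IsLinearSEM.isTight_dotProduct_E_ε [IsProbabilityMeasure μ] [NeZero q]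
    (h : IsLinearSEM μ T X M Y E ε α β τ ζM ζY)
    (hm : MomentCondition μ T X E ε covE varε covX varT) (j : Fin p) :
    IsTight μ fun x : ℝ × ℕ × Ω => ((fun i : Fin x.2.1 => E i x.2.2 j) ⬝ᵥ
      fun i : Fin x.2.1 => ε i x.2.2) / √(x.2.1 : ℝ) := by
  have hind : IndepFun (fun ω => E 0 ω j) (ε 0) μ :=
    (h.indep_E_ε 0).comp (measurable_pi_apply j) measurable_id
  have hmean : ∫ ω, E 0 ω j * ε 0 ω ∂μ = 0 := by
    have := hind.integral_mul_eq_mul_integral (h.integrable_E 0 j).1 (h.integrable_ε 0).1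
    simp only [Pi.mul_apply] at this
    rw [this, h.mean_E, zero_mul]
  have hL : MemLp (fun ω => E 0 ω j * ε 0 ω) 2 μ := by
    refine (memLp_two_iff_integrable_sq ((h.integrable_E 0 j).1.mul (h.integrable_ε 0).1)).2 ?_
    have h1 : IndepFun (fun ω => E 0 ω j ^ 2) (fun ω => ε 0 ω ^ 2) μ :=
      hind.comp (φ := fun t : ℝ => t ^ 2) (ψ := fun t : ℝ => t ^ 2) (by fun_prop) (by fun_prop)
    refine (h1.integrable_mul (hm.memLp_E 0 j).integrable_sq
      (hm.memLp_ε 0).integrable_sq).congr (Eventually.of_forall fun ω => ?_)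
    simp [mul_pow]
  have h2 := h.isTight_sum_mul (φ := fun e => e.1 j * e.2) (by fun_prop) hL hmean
    (ψ := fun n _ _ => 1) (fun n => measurable_const) (by
      refine (isTight_const 1).congr ?_
      filter_upwards [eventually_index_pos] with x hx
      simp [hx.ne'])
  simpa only [one_mul, dotProduct] using h2

/-- The matrix of the errors `E` projected off `T` and `X`. -/
noncomputable def residualE (T : ℕ → Ω → ℝ) (X : ℕ → Ω → Fin q → ℝ) (E : ℕ → Ω → Fin p → ℝ)
    (n : ℕ) (ω : Ω) : Matrix (Fin n) (Fin p) ℝ :=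
  Matrix.of fun i j => residual (sampleVec T n ω) (sampleMat X n ω) (fun i => E i ω j) i

/-- The projection costs `O_p(1)`, which disappears after division by `n`, so the limit is that of
the unprojected errors. -/
theorem IsLinearSEM.tendsto_gram_residualE [IsProbabilityMeasure μ] [NeZero q]
    (h : IsLinearSEM μ T X M Y E ε α β τ ζM ζY)
    (hm : MomentCondition μ T X E ε covE varε covX varT) (j k : Fin p) :
    Tendsto (fun x : ℝ × ℕ × Ω => ((residualE T X E x.2.1 x.2.2)ᵀ *
      residualE T X E x.2.1 x.2.2) j k / (x.2.1 : ℝ)) (tightFilter μ) (𝓝 (covE j k)) := by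
  obtain ⟨hXj, hRj⟩ := h.isTight_scores hm (φ := fun e => e.1 j) (by fun_prop) (hm.memLp_E 0 j)
    (h.mean_E 0 j)
  obtain ⟨hXk, hRk⟩ := h.isTight_scores hm (φ := fun e => e.1 k) (by fun_prop) (hm.memLp_E 0 k)
    (h.mean_E 0 k)
  have h1 := (hm.isTight_sub_residual_dotProduct hXj hXk hRj hRk).tendsto_zero
    (tendsto_inv_atTop_nhds_zero_nat (𝕜 := ℝ))
  have h2 := (h.tendsto_gram_E hm j k).sub h1
  rw [sub_zero] at h2
  refine h2.congr' ?_
  filter_upwards [hm.eventually_isUnit_det, hm.eventually_residualT_ne_zero] with x hu hR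
  have h3 : ((residualE T X E x.2.1 x.2.2)ᵀ * residualE T X E x.2.1 x.2.2) j k =
    residual (sampleVec T x.2.1 x.2.2) (sampleMat X x.2.1 x.2.2) (fun i => E i x.2.2 j) ⬝ᵥ
      residual (sampleVec T x.2.1 x.2.2) (sampleMat X x.2.1 x.2.2) (fun i => E i x.2.2 k) := rfl
  rw [h3, residual_dotProduct_residual hu hR]
  ring

theorem IsLinearSEM.isTight_residualE_mulVec [IsProbabilityMeasure μ] [NeZero q]
    (h : IsLinearSEM μ T X M Y E ε α β τ ζM ζY)
    (hm : MomentCondition μ T X E ε covE varε covX varT) (j : Fin p) :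
    IsTight μ fun x : ℝ × ℕ × Ω => ((residualE T X E x.2.1 x.2.2)ᵀ *ᵥ
      sampleVec ε x.2.1 x.2.2) j / √(x.2.1 : ℝ) := by
  obtain ⟨hXj, hRj⟩ := h.isTight_scores hm (φ := fun e => e.1 j) (by fun_prop) (hm.memLp_E 0 j)
    (h.mean_E 0 j)
  obtain ⟨hXε, hRε⟩ := h.isTight_scores hm (φ := fun e => e.2) (by fun_prop) (hm.memLp_ε 0)
    (h.mean_ε 0)
  have h0 : Tendsto (fun n : ℕ => (√(n : ℝ))⁻¹) atTop (𝓝 0) :=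
    (Real.tendsto_sqrt_atTop.comp tendsto_natCast_atTop_atTop).inv_tendsto_atTop
  have h1 := isTight_of_tendsto
    ((hm.isTight_sub_residual_dotProduct hXj hXε hRj hRε).tendsto_zero h0)
  refine ((h.isTight_dotProduct_E_ε hm j).sub h1).congr (Eventually.of_forall fun x => ?_)
  have h3 : ((residualE T X E x.2.1 x.2.2)ᵀ *ᵥ sampleVec ε x.2.1 x.2.2) j =
    residual (sampleVec T x.2.1 x.2.2) (sampleMat X x.2.1 x.2.2) (fun i => E i x.2.2 j) ⬝ᵥ
      fun i => ε i x.2.2 := rfl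
  rw [h3]
  ring

end Scores

/-! ### Penalty levels on and off the support. -/

section Weights

variable {Ω : Type*} [MeasurableSpace Ω] {μ : Measure Ω} {p : ℕ} {a0 b0 : ℕ → Ω → Fin p → ℝ}
  {a b : Fin p → ℝ}

theorem InitialCondition.tendsto (h : InitialCondition μ a0 a) (j : Fin p) :
    Tendsto (fun x : ℝ × ℕ × Ω => a0 x.2.1 x.2.2 j) (tightFilter μ) (𝓝 (a j)) := by
  have h0 : Tendsto (fun n : ℕ => (√(n : ℝ))⁻¹) atTop (𝓝 0) :=
    (Real.tendsto_sqrt_atTop.comp tendsto_natCast_atTop_atTop).inv_tendsto_atTop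
  have h1 := (((h j).1.isTight).tendsto_zero h0).add_const (a j)
  rw [zero_add] at h1
  refine h1.congr' ?_
  filter_upwards [tendsto_index.eventually_gt_atTop 0] with x hx
  have hs : √(x.2.1 : ℝ) ≠ 0 := (Real.sqrt_pos.mpr (by exact_mod_cast hx)).ne'
  rw [← mul_assoc, inv_mul_cancel₀ hs, one_mul, sub_add_cancel]

theorem weight_nonneg (γ η : ℝ) (u v : Fin p → ℝ) (j : Fin p) : 0 ≤ weight γ η u v j :=
  add_nonneg (Real.rpow_nonneg (abs_nonneg _) _) (Real.rpow_nonneg (abs_nonneg _) _)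

theorem weight_pos {γ η : ℝ} {u : Fin p → ℝ} (v : Fin p → ℝ) {j : Fin p} (h : u j ≠ 0) :
    0 < weight γ η u v j :=
  add_pos_of_nonneg_of_pos (Real.rpow_nonneg (abs_nonneg _) _)
    (Real.rpow_pos_of_pos (abs_pos.mpr h) _)

theorem InitialCondition.eventually_weight_pos (h : InitialCondition μ a0 a) (γ η : ℝ) :
    ∀ᶠ x : ℝ × ℕ × Ω in tightFilter μ, ∀ j,
      0 < weight γ η (a0 x.2.1 x.2.2) (b0 x.2.1 x.2.2) j := by
  rw [eventually_all]
  intro j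
  filter_upwards [(h j).2.eventually_ne_zero (Z := fun n ω => a0 n ω j)] with x hx
  exact weight_pos _ hx

/-- The penalty level of a nonzero coefficient is `O_p(√n)`. -/
theorem InitialCondition.isTight_penalty (h : InitialCondition μ a0 a) {γ η : ℝ} (hη : 0 < 2 * η)
    {lam : ℕ → ℝ} (hupper : lam =o[atTop] fun n : ℕ => (n : ℝ) ^ (1 / 2 : ℝ)) {j : Fin p}
    (hj : a j ≠ 0) :
    IsTight μ fun x : ℝ × ℕ × Ω =>
      lam x.2.1 / weight γ η (a0 x.2.1 x.2.2) (b0 x.2.1 x.2.2) j / √(x.2.1 : ℝ) := by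
  have hpos : 0 < |a j| / 2 := by positivity
  -- Eventually the initial estimate exceeds half of its limit in absolute value; the product term
  -- of the weight is dropped.
  refine ⟨fun _ => 1 / (|a j| / 2) ^ (2 * η), ?_⟩
  filter_upwards [(h.tendsto j).abs.eventually_const_lt (half_lt_self (abs_pos.mpr hj)),
    tendsto_index.eventually (hupper.bound one_pos),
    tendsto_index.eventually_gt_atTop 0] with x h1 h2 h3
  have hs : 0 < √(x.2.1 : ℝ) := Real.sqrt_pos.mpr (by exact_mod_cast h3)
  have hw : (|a j| / 2) ^ (2 * η) ≤ weight γ η (a0 x.2.1 x.2.2) (b0 x.2.1 x.2.2) j :=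
    (Real.rpow_le_rpow hpos.le h1.le hη.le).trans
      (le_add_of_nonneg_left (Real.rpow_nonneg (abs_nonneg _) _))
  have hw0 : 0 < (|a j| / 2) ^ (2 * η) := Real.rpow_pos_of_pos hpos _
  rw [← Real.sqrt_eq_rpow, one_mul, Real.norm_eq_abs, Real.norm_eq_abs, abs_of_pos hs] at h2
  rw [abs_div, abs_div, abs_of_pos hs, abs_of_pos (hw0.trans_le hw), div_right_comm]
  exact div_le_div₀ zero_le_one ((div_le_one hs).2 h2) hw0 hw

/-- The penalty level of a zero coefficient is of larger order than `√n`. -/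
theorem InitialCondition.eventually_lt_penalty (h : InitialCondition μ a0 a)
    (h' : InitialCondition μ b0 b) {γ η : ℝ} (hη : 0 < 2 * η) (hγ : 2 * η < γ)
    {lam : ℕ → ℝ} (hnonneg : ∀ n, 0 ≤ lam n)
    (hlower : (fun n : ℕ => (n : ℝ) ^ (1 / 2 - η)) =o[atTop] lam) {j : Fin p}
    (hj : a j = 0) (f : ℝ → ℝ) :
    ∀ᶠ x : ℝ × ℕ × Ω in tightFilter μ,
      f x.1 < lam x.2.1 / weight γ η (a0 x.2.1 x.2.2) (b0 x.2.1 x.2.2) j / √(x.2.1 : ℝ) := by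
  obtain ⟨fa, hfa⟩ := (h j).1.isTight
  obtain ⟨fb, hfb⟩ := isTight_of_tendsto (h'.tendsto j)
  -- `W K * n ^ (-η)` bounds the weight; the `1` makes `W` positive.
  set W : ℝ → ℝ := fun K => (|fa K| * |fb K|) ^ γ + |fa K| ^ (2 * η) + 1 with hW
  have hW0 : ∀ K, 0 < W K := fun K => by positivity
  have hl : ∀ᶠ x : ℝ × ℕ × Ω in tightFilter μ,
      (|f x.1| + 1) * W x.1 * (x.2.1 : ℝ) ^ (1 / 2 - η) ≤ lam x.2.1 := by
    refine eventually_const (P := fun K n => (|f K| + 1) * W K * (n : ℝ) ^ (1 / 2 - η) ≤ lam n)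
      (Eventually.of_forall fun K => ?_)
    have hc : 0 < (|f K| + 1) * W K := mul_pos (by positivity) (hW0 K)
    filter_upwards [hlower.bound (inv_pos.mpr hc)] with n hn
    rw [Real.norm_of_nonneg (Real.rpow_nonneg (Nat.cast_nonneg _) _),
      Real.norm_of_nonneg (hnonneg n)] at hn
    have := mul_le_mul_of_nonneg_left hn hc.le
    rwa [← mul_assoc _ _ (lam n), mul_inv_cancel₀ hc.ne', one_mul] at this
  filter_upwards [hfa, hfb, hl, h.eventually_weight_pos (b0 := b0) γ η,
    tendsto_index.eventually_ge_atTop 1] with x h1 h2 h3 h4 h5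
  have hn1 : (1 : ℝ) ≤ x.2.1 := by exact_mod_cast h5
  have hn : (0 : ℝ) < x.2.1 := by linarith
  have hs : 0 < √(x.2.1 : ℝ) := Real.sqrt_pos.mpr hn
  have ha : |a0 x.2.1 x.2.2 j| ≤ |fa x.1| * (x.2.1 : ℝ) ^ (-(1 / 2) : ℝ) := by
    rw [hj, sub_zero, abs_mul, abs_of_pos hs] at h1
    rw [Real.rpow_neg hn.le, ← Real.sqrt_eq_rpow, ← div_eq_mul_inv, le_div_iff₀ hs, mul_comm]
    exact h1.trans (le_abs_self _)
  have hb : |b0 x.2.1 x.2.2 j| ≤ |fb x.1| := h2.trans (le_abs_self _)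
  have hw1 : |a0 x.2.1 x.2.2 j * b0 x.2.1 x.2.2 j| ^ γ ≤
      (|fa x.1| * |fb x.1|) ^ γ * (x.2.1 : ℝ) ^ (-η) := by
    have e1 : |a0 x.2.1 x.2.2 j * b0 x.2.1 x.2.2 j| ≤
        |fa x.1| * |fb x.1| * (x.2.1 : ℝ) ^ (-(1 / 2) : ℝ) := by
      rw [abs_mul, mul_right_comm]
      exact mul_le_mul ha hb (abs_nonneg _) (by positivity)
    -- Here `γ > 2η` enters: `n ^ (-γ / 2) ≤ n ^ (-η)` for `n ≥ 1`, so the product term is no larger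
    -- in order than the other one.
    refine (Real.rpow_le_rpow (abs_nonneg _) e1 (by linarith)).trans ?_
    rw [Real.mul_rpow (by positivity) (by positivity), ← Real.rpow_mul hn.le]
    refine mul_le_mul_of_nonneg_left (Real.rpow_le_rpow_of_exponent_le hn1 (by linarith))
      (by positivity)
  have hw2 : |a0 x.2.1 x.2.2 j| ^ (2 * η) ≤ |fa x.1| ^ (2 * η) * (x.2.1 : ℝ) ^ (-η) := by
    refine (Real.rpow_le_rpow (abs_nonneg _) ha hη.le).trans (le_of_eq ?_)
    rw [Real.mul_rpow (by positivity) (by positivity), ← Real.rpow_mul hn.le]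
    congr 2
    ring
  have hw : weight γ η (a0 x.2.1 x.2.2) (b0 x.2.1 x.2.2) j ≤ W x.1 * (x.2.1 : ℝ) ^ (-η) := by
    have : 0 ≤ (x.2.1 : ℝ) ^ (-η) := by positivity
    unfold weight
    rw [hW]
    dsimp only
    linarith
  rw [lt_div_iff₀ hs, lt_div_iff₀ (h4 j)]
  have hsplit : (x.2.1 : ℝ) ^ (1 / 2 - η) = √(x.2.1 : ℝ) * (x.2.1 : ℝ) ^ (-η) := by
    rw [Real.sqrt_eq_rpow, ← Real.rpow_add hn, sub_eq_add_neg]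
  have hp : 0 < W x.1 * (x.2.1 : ℝ) ^ (1 / 2 - η) :=
    mul_pos (hW0 _) (Real.rpow_pos_of_pos hn _)
  calc f x.1 * √(x.2.1 : ℝ) * weight γ η (a0 x.2.1 x.2.2) (b0 x.2.1 x.2.2) j
      ≤ |f x.1| * √(x.2.1 : ℝ) * weight γ η (a0 x.2.1 x.2.2) (b0 x.2.1 x.2.2) j := by
        gcongr
        · exact weight_nonneg _ _ _ _ _
        · exact le_abs_self _
    _ ≤ |f x.1| * √(x.2.1 : ℝ) * (W x.1 * (x.2.1 : ℝ) ^ (-η)) := by gcongr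
    _ = |f x.1| * (W x.1 * (x.2.1 : ℝ) ^ (1 / 2 - η)) := by rw [hsplit]; ring
    _ < (|f x.1| + 1) * (W x.1 * (x.2.1 : ℝ) ^ (1 / 2 - η)) := by linarith
    _ ≤ lam x.2.1 := by rw [← mul_assoc]; exact h3

end Weights

/-! ### The mediator and outcome regressions, and the joint conclusion. -/

section Main

variable {Ω : Type*} [MeasurableSpace Ω] {μ : Measure Ω} {p q : ℕ}
  [NeZero q] {T : ℕ → Ω → ℝ} {X : ℕ → Ω → Fin q → ℝ} {M : ℕ → Ω → Fin p → ℝ} {Y : ℕ → Ω → ℝ}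
  {E : ℕ → Ω → Fin p → ℝ} {ε : ℕ → Ω → ℝ} {α β : Fin p → ℝ} {τ : ℝ}
  {ζM : Matrix (Fin q) (Fin p) ℝ} {ζY : Fin q → ℝ}
  {covE : Matrix (Fin p) (Fin p) ℝ} {varε : ℝ} {covX : Matrix (Fin q) (Fin q) ℝ} {varT : ℝ}
  {α0 β0 : ℕ → Ω → Fin p → ℝ} {γ η : ℝ} {lam : ℕ → ℝ}

theorem IsLinearSEM.sampleMat_mediator (h : IsLinearSEM μ T X M Y E ε α β τ ζM ζY) (n : ℕ)
    (ω : Ω) : sampleMat M n ω = vecMulVec (sampleVec T n ω) α + sampleMat X n ω * ζM +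
      sampleMat E n ω := by
  ext i j
  have h1 := congrFun (h.mediator_eq i ω) j
  simp only [sampleMat, Matrix.of_apply, Matrix.add_apply, vecMulVec_apply, Matrix.mul_apply,
    sampleVec, h1, Pi.add_apply, Pi.smul_apply, smul_eq_mul, mulVec, dotProduct, transpose_apply]
  simp only [mul_comm]

theorem IsLinearSEM.sampleVec_outcome (h : IsLinearSEM μ T X M Y E ε α β τ ζM ζY) (n : ℕ)
    (ω : Ω) : sampleVec Y n ω = τ • sampleVec T n ω + sampleMat M n ω *ᵥ β +
      sampleMat X n ω *ᵥ ζY + sampleVec ε n ω := by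
  ext i
  simp only [sampleVec, h.outcome_eq i ω, Pi.add_apply, Pi.smul_apply, smul_eq_mul, mulVec,
    dotProduct, sampleMat, Matrix.of_apply]
  simp only [mul_comm]

/-- Consistency and selection for the mediator model. -/
theorem IsMediatorFit.tendsto_and_eventually_eq_zero [IsProbabilityMeasure μ]
    {θ : ℕ → Ω → Matrix (Unit ⊕ Fin q) (Fin p) ℝ}
    (hθ : IsMediatorFit μ T X M lam (fun n ω => weight γ η (α0 n ω) (β0 n ω)) θ)
    (h : IsLinearSEM μ T X M Y E ε α β τ ζM ζY)
    (hm : MomentCondition μ T X E ε covE varε covX varT)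
    (hα0 : InitialCondition μ α0 α) (hβ0 : InitialCondition μ β0 β)
    (hη : 0 < 2 * η) (hγ : 2 * η < γ) (hnonneg : ∀ n, 0 ≤ lam n)
    (hlower : (fun n : ℕ => (n : ℝ) ^ (1 / 2 - η)) =o[atTop] lam)
    (hupper : lam =o[atTop] fun n : ℕ => (n : ℝ) ^ (1 / 2 : ℝ)) :
    (∀ j, Tendsto (fun x : ℝ × ℕ × Ω => alphaPart (θ x.2.1 x.2.2) j - α j) (tightFilter μ)
      (𝓝 0)) ∧
      ∀ᶠ x : ℝ × ℕ × Ω in tightFilter μ, ∀ j, α j = 0 →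
        alphaPart (θ x.2.1 x.2.2) j - α j = 0 := by
  refine tendsto_and_eventually_eq_zero_of_quadLoss_minimal
    (d := fun x => alphaPart (θ x.2.1 x.2.2) - α)
    (G := fun x => (residualT T X x.2.1 x.2.2 ⬝ᵥ residualT T X x.2.1 x.2.2) • 1)
    (S := varT • 1)
    (g := fun x => (sampleMat E x.2.1 x.2.2)ᵀ *ᵥ residualT T X x.2.1 x.2.2)
    (pen := fun x j => lam x.2.1 / weight γ η (α0 x.2.1 x.2.2) (β0 x.2.1 x.2.2) j)
    (PosDef.one.smul hm.varT_pos) (fun x => by simp) (fun j k => ?_) (fun j => ?_)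
    (Eventually.of_forall fun x j => div_nonneg (hnonneg _) (weight_nonneg _ _ _ _ _))
    (fun j hj => hα0.isTight_penalty hη hupper hj)
    (fun j hj f => hα0.eventually_lt_penalty hβ0 hη hγ hnonneg hlower hj f) ?_
  · have := hm.tendsto_dotProduct_residualT.mul_const ((1 : Matrix (Fin p) (Fin p) ℝ) j k)
    refine this.congr fun x => ?_
    rw [Matrix.smul_apply, smul_eq_mul, div_mul_eq_mul_div]
  · refine (h.isTight_scores hm (φ := fun e => e.1 j) (by fun_prop) (hm.memLp_E 0 j)
      (h.mean_E 0 j)).2.congr (Eventually.of_forall fun x => ?_)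
    rw [dotProduct_comm]
    rfl
  · filter_upwards [eventually_of_ae hθ, hα0.eventually_weight_pos (b0 := β0) γ η,
      hm.eventually_isUnit_det] with x hx hw hu
    exact quadLoss_le_of_objectiveM_minimal (h.sampleMat_mediator _ _) (projPerp_mulVec _ _)
      (transpose_mulVec_projPerp hu _) (hx fun j => (hw j).ne')

/-- Consistency and selection for the outcome model. -/
theorem IsOutcomeFit.tendsto_and_eventually_eq_zero [IsProbabilityMeasure μ]
    {θ : ℕ → Ω → (Unit ⊕ Fin q) ⊕ Fin p → ℝ}
    (hθ : IsOutcomeFit μ T X M Y lam (fun n ω => weight γ η (β0 n ω) (α0 n ω)) θ)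
    (h : IsLinearSEM μ T X M Y E ε α β τ ζM ζY)
    (hm : MomentCondition μ T X E ε covE varε covX varT)
    (hα0 : InitialCondition μ α0 α) (hβ0 : InitialCondition μ β0 β)
    (hη : 0 < 2 * η) (hγ : 2 * η < γ) (hnonneg : ∀ n, 0 ≤ lam n)
    (hlower : (fun n : ℕ => (n : ℝ) ^ (1 / 2 - η)) =o[atTop] lam)
    (hupper : lam =o[atTop] fun n : ℕ => (n : ℝ) ^ (1 / 2 : ℝ)) :
    (∀ j, Tendsto (fun x : ℝ × ℕ × Ω => betaPart (θ x.2.1 x.2.2) j - β j) (tightFilter μ)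
      (𝓝 0)) ∧
      ∀ᶠ x : ℝ × ℕ × Ω in tightFilter μ, ∀ j, β j = 0 →
        betaPart (θ x.2.1 x.2.2) j - β j = 0 := by
  refine tendsto_and_eventually_eq_zero_of_quadLoss_minimal
    (d := fun x => betaPart (θ x.2.1 x.2.2) - β)
    (G := fun x => (residualE T X E x.2.1 x.2.2)ᵀ * residualE T X E x.2.1 x.2.2)
    (g := fun x => (residualE T X E x.2.1 x.2.2)ᵀ *ᵥ sampleVec ε x.2.1 x.2.2)
    (pen := fun x j => lam x.2.1 / weight γ η (β0 x.2.1 x.2.2) (α0 x.2.1 x.2.2) j)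
    hm.covE_posDef (fun x => by rw [transpose_mul, transpose_transpose])
    (h.tendsto_gram_residualE hm) (h.isTight_residualE_mulVec hm)
    (Eventually.of_forall fun x j => div_nonneg (hnonneg _) (weight_nonneg _ _ _ _ _))
    (fun j hj => hβ0.isTight_penalty hη hupper hj)
    (fun j hj f => hβ0.eventually_lt_penalty hα0 hη hγ hnonneg hlower hj f) ?_
  filter_upwards [eventually_of_ae hθ, hβ0.eventually_weight_pos (b0 := α0) γ η,
    hm.eventually_isUnit_det, hm.eventually_residualT_ne_zero] with x hx hw hu hR
  -- The projection is applied to each column of `E`; the coefficients of the columns are assembled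
  -- into the vector `c` and the matrix with columns `b j`.
  choose c b hcb using fun j => exists_residual_eq (sampleVec T x.2.1 x.2.2)
    (sampleMat X x.2.1 x.2.2) fun i => E i x.2.2 j
  refine quadLoss_le_of_objectiveY_minimal (c := c) (B := (Matrix.of b)ᵀ)
    (h.sampleMat_mediator _ _) (h.sampleVec_outcome _ _) ?_ ?_ ?_ (hx fun j => (hw j).ne')
  · ext i j
    have := congrFun (hcb j) i
    simp only [Pi.sub_apply, Pi.smul_apply, smul_eq_mul, mulVec, dotProduct] at this
    simp only [residualE, Matrix.of_apply, this, Matrix.sub_apply, vecMulVec_apply,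
      Matrix.mul_apply, transpose_apply, mul_comm (c j)]
    rfl
  · ext j
    have := dotProduct_residual hu hR fun i => E i x.2.2 j
    rw [dotProduct_comm] at this
    exact this
  · ext j k
    have := congrFun (transpose_mulVec_residual hu (sampleVec T x.2.1 x.2.2)
      fun i => E i x.2.2 j) k
    rw [mulVec, dotProduct_comm] at this
    exact this

end Main

end JointAdaptivePenalty

theorem theorem1 {Ω : Type*} [MeasurableSpace Ω] (μ : Measure Ω) [IsProbabilityMeasure μ]
    {p q : ℕ} [NeZero q]
    -- data, errors and true coefficients
    (T : ℕ → Ω → ℝ) (X : ℕ → Ω → Fin q → ℝ) (M : ℕ → Ω → Fin p → ℝ) (Y : ℕ → Ω → ℝ)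
    (E : ℕ → Ω → Fin p → ℝ) (ε : ℕ → Ω → ℝ)
    (α β : Fin p → ℝ) (τ : ℝ) (ζM : Matrix (Fin q) (Fin p) ℝ) (ζY : Fin q → ℝ)
    (hmodel : JointAdaptivePenalty.IsLinearSEM μ T X M Y E ε α β τ ζM ζY)
    -- moment condition
    (covE : Matrix (Fin p) (Fin p) ℝ) (varε : ℝ) (covX : Matrix (Fin q) (Fin q) ℝ) (varT : ℝ)
    (hmoments : JointAdaptivePenalty.MomentCondition μ T X E ε covE varε covX varT)
    -- initial estimates
    (α0 β0 : ℕ → Ω → Fin p → ℝ)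
    (hα0 : JointAdaptivePenalty.InitialCondition μ α0 α)
    (hβ0 : JointAdaptivePenalty.InitialCondition μ β0 β)
    -- exponents of the weights and tuning parameters
    (γα ηα γβ ηβ : ℝ) (hηα : 0 < 2 * ηα) (hγα : 2 * ηα < γα) (hηβ : 0 < 2 * ηβ)
    (hγβ : 2 * ηβ < γβ)
    (lamα lamβ : ℕ → ℝ) (hlamα_nonneg : ∀ n, 0 ≤ lamα n) (hlamβ_nonneg : ∀ n, 0 ≤ lamβ n)
    (hlamα_lower : (fun n : ℕ => (n : ℝ) ^ (1 / 2 - ηα)) =o[atTop] lamα)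
    (hlamα_upper : lamα =o[atTop] (fun n : ℕ => (n : ℝ) ^ (1 / 2 : ℝ)))
    (hlamβ_lower : (fun n : ℕ => (n : ℝ) ^ (1 / 2 - ηβ)) =o[atTop] lamβ)
    (hlamβ_upper : lamβ =o[atTop] (fun n : ℕ => (n : ℝ) ^ (1 / 2 : ℝ)))
    -- joint adaptive penalized estimates
    (θM : ℕ → Ω → Matrix (Unit ⊕ Fin q) (Fin p) ℝ)
    (hθM : JointAdaptivePenalty.IsMediatorFit μ T X M lamα
      (fun n ω => JointAdaptivePenalty.weight γα ηα (α0 n ω) (β0 n ω)) θM)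
    (θY : ℕ → Ω → (Unit ⊕ Fin q) ⊕ Fin p → ℝ)
    (hθY : JointAdaptivePenalty.IsOutcomeFit μ T X M Y lamβ
      (fun n ω => JointAdaptivePenalty.weight γβ ηβ (β0 n ω) (α0 n ω)) θY) :
    TendstoInMeasure μ
      (fun n ω => ∑ j, (JointAdaptivePenalty.alphaPart (θM n ω) j - α j) ^ 2 +
        ∑ j, (JointAdaptivePenalty.betaPart (θY n ω) j - β j) ^ 2)
      atTop (fun _ => (0 : ℝ)) ∧
    Tendsto
      (fun n => μ {ω | JointAdaptivePenalty.activeSet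
          (JointAdaptivePenalty.alphaPart (θM n ω)) (JointAdaptivePenalty.betaPart (θY n ω)) =
        JointAdaptivePenalty.activeSet α β})
      atTop (𝓝 1) := by
  obtain ⟨hα, hα'⟩ := hθM.tendsto_and_eventually_eq_zero hmodel hmoments hα0 hβ0 hηα hγα
    hlamα_nonneg hlamα_lower hlamα_upper
  obtain ⟨hβ, hβ'⟩ := hθY.tendsto_and_eventually_eq_zero hmodel hmoments hα0 hβ0 hηβ hγβ
    hlamβ_nonneg hlamβ_lower hlamβ_upper
  constructor
  · rw [← JointAdaptivePenalty.tendsto_iff_tendstoInMeasure]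
    have h := (tendsto_finsetSum Finset.univ fun j _ => (hα j).pow 2).add
      (tendsto_finsetSum Finset.univ fun j _ => (hβ j).pow 2)
    simpa using h
  · refine JointAdaptivePenalty.tendsto_measure_one_of_eventually (P := fun n ω =>
      JointAdaptivePenalty.activeSet (JointAdaptivePenalty.alphaPart (θM n ω))
        (JointAdaptivePenalty.betaPart (θY n ω)) = JointAdaptivePenalty.activeSet α β) ?_
    have hne : ∀ᶠ x : ℝ × ℕ × Ω in JointAdaptivePenalty.tightFilter μ, ∀ j, α j * β j ≠ 0 →
        JointAdaptivePenalty.alphaPart (θM x.2.1 x.2.2) j *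
          JointAdaptivePenalty.betaPart (θY x.2.1 x.2.2) j ≠ 0 := by
      rw [eventually_all]
      intro j
      by_cases hj : α j * β j = 0
      · exact Eventually.of_forall fun x h => absurd hj h
      have h := ((hα j).add_const (α j)).mul ((hβ j).add_const (β j))
      simp only [sub_add_cancel, zero_add] at h
      filter_upwards [h.eventually_ne hj] with x hx _ using hx
    filter_upwards [hα', hβ', hne] with x h1 h2 h3
    ext j
    -- One exactly vanishing estimate suffices for an inactive index, whatever the other factor is.
    refine ⟨fun hj h0 => hj ?_, h3 j⟩
    rcases mul_eq_zero.1 h0 with h0 | h0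
    · have := h1 j h0
      rw [h0, sub_zero] at this
      rw [this, zero_mul]
    · have := h2 j h0
      rw [h0, sub_zero] at this
      rw [this, mul_zero]
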